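/- Let $G(z,\bar z)$ be a function of two independent complex variables of the form $$G(z,\bar z)=z^{-\Delta}\bar z^{-\Delta}\sum_{k=0}^{\infty}\sum_{j=0}^{l_k}c_{k,j}\,z^{\frac{E_k-l_k}{2}+j}\,\bar z^{\frac{E_k+l_k}{2}-j},$$ with $\Delta>0$, $E_k\ge 0$ real, $l_k\in\mathbb N_0$ and $c_{k,j}=c_{k,l_k-j}\ge 0$. Assume that the double sum converges absolutely for $0<|z|,|\bar z|<1$, that $E_k\to\infty$, that $E_0=l_0=0$ and $c_{0,0}=1$ (identity contribution), that $\inf_{k>0}(E_k-l_k)>0$ (twist gap), and that $G(z,\bar z)=G(1-z,1-\bar z)$ whenever $|z|,|1-z|,|\bar z|,|1-\bar z|<1$ (crossing symmetry). For $v\ge 0$ and $0<\bar z<1$ let $$\kappa(v,\bar z)=\frac{(\bar z/4)^v}{\sqrt{v+1}}\;{}_2F_1(v,v;2v;\bar z),\qquad \kappa(0,\bar z)=1 .$$ Suppose that $G$ has an expansion in lightcone blocks with nonnegative coefficients: there are families of reals $h_i\ge 0$, $\bar h_i\ge 0$, $d_i\ge 0$ (with $i$ in some index set) such that, for all $z,\bar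 z\in(0,1)$, $$G(z,\bar z)=\bar z^{-\Delta}\sum_i d_i\,z^{h_i-\Delta}\,\kappa(\bar h_i,\bar z).$$ For real $\Lambda$ and $\operatorname{Re} w<0$ put, for each value $v$ in the set $\{\bar h_i\}$, $$f^{(lc)}_v(w)=\sum_{i:\,\bar h_i=v}d_i\,e^{(h_i-\Delta)w},\qquad F^{(lc)}_\Lambda(w)=\frac{\Gamma(\Delta)\Gamma(\Delta+1)}{2\sqrt\pi}\,\Lambda^{-2\Delta}\sum_{v\in\{\bar h_i\},\,v\le\Lambda}f^{(lc)}_v(w),\qquad H^{(lc)}_\Lambda=\sum_{i:\,\bar h_i\le\Lambda}d_i\,\delta_{h_i}.$$ Then: 1. For every $w\in\mathbb C$ with $\operatorname{Re}w<0$, the sum $\sum_{i:\,\bar h_i\le\Lambda}d_i e^{(h_i-\Delta)w}$ converges absolutely for every $\Lambda$, and $$\lim_{\Lambda\to\infty}F^{(lc)}_\Lambda(w)=(1-e^w)^{-\Delta}.$$ 2. For every compactly supported $\phi\in C^\infty(\mathbb R;\mathbb C)$, the function $\phi$ is integrable with respect to the measure $H^{(lc)}_\Lambda$ for every $\Lambda$,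 and $$\lim_{\Lambda\to\infty}\Lambda^{-2\Delta}\int\phi(\eta)\,dH^{(lc)}_\Lambda(\eta)=\sum_{m=0}^{\infty}\frac{2\sqrt\pi\,\Gamma(m+\Delta)}{m!\,\Gamma(\Delta)^2\,\Gamma(\Delta+1)}\,\phi(\Delta+m).$$ -/

import Mathlib

open scoped ContDiff

noncomputable section

/-- Exponents and coefficients of a double series
`z^(-Δ) * zb^(-Δ) * ∑ k, ∑ j ≤ l k, c k j * z^((E k - l k)/2 + j) * zb^((E k + l k)/2 - j)`. -/
structure CorrelatorData where
  Δ : ℝ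
  E : ℕ → ℝ
  l : ℕ → ℕ
  c : ℕ → ℕ → ℝ

namespace CorrelatorData

variable (D : CorrelatorData)

/-- The labels `(k, j)` with `0 ≤ j ≤ l k` of the monomials. -/
abbrev Label : Type := Σ k : ℕ, Fin (D.l k + 1)

/-- The exponent of `z` in a monomial. -/
def h (p : D.Label) : ℝ := (D.E p.1 - D.l p.1) / 2 + ((p.2 : ℕ) : ℝ)

/-- The exponent of `zb` in a monomial. -/
def hbar (p : D.Label) : ℝ := (D.E p.1 + D.l p.1) / 2 - ((p.2 : ℕ) : ℝ)

/-- One term of the double sum; powers are principal values. -/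
def term (z zb : ℂ) (p : D.Label) : ℂ :=
  (D.c p.1 p.2 : ℂ) * z ^ (D.h p : ℂ) * zb ^ (D.hbar p : ℂ)

/-- The function `G(z, zb)`, for independent complex variables `z` and `zb`. -/
def G (z zb : ℂ) : ℂ :=
  z ^ (-D.Δ : ℂ) * zb ^ (-D.Δ : ℂ) * ∑' p : D.Label, D.term z zb p

/-- The standing assumptions on the four-point function `G`. -/
structure IsCorrelator : Prop where
  Δ_pos : 0 < D.Δ
  E_nonneg : ∀ k, 0 ≤ D.E k
  c_nonneg : ∀ k j, j ≤ D.l k → 0 ≤ D.c k j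
  c_symm : ∀ k j, j ≤ D.l k → D.c k j = D.c k (D.l k - j)
  /-- Absolute convergence in the punctured unit polydisk. -/
  abs_conv : ∀ z zb : ℂ, 0 < ‖z‖ → ‖z‖ < 1 → 0 < ‖zb‖ → ‖zb‖ < 1 →
    Summable fun p : D.Label => ‖D.term z zb p‖
  /-- Discrete spectrum. -/
  discrete : Filter.Tendsto D.E Filter.atTop Filter.atTop
  /-- Identity contribution. -/
  E_zero : D.E 0 = 0
  l_zero : D.l 0 = 0
  c_zero : D.c 0 0 = 1
  /-- Twist gap: the infimum of `E k - l k` over `k > 0` is positive. -/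
  twist_gap : ∃ τ : ℝ, 0 < τ ∧ ∀ k, 0 < k → τ ≤ D.E k - D.l k
  /-- Crossing symmetry, wherever both sides are given by the convergent series. -/
  crossing : ∀ z zb : ℂ, ‖z‖ < 1 → ‖1 - z‖ < 1 → ‖zb‖ < 1 → ‖1 - zb‖ < 1 →
    D.G z zb = D.G (1 - z) (1 - zb)

end CorrelatorData

/-- The lightcone conformal block
`κ(v, y) = (y/4)^v * (v+1)^(-1/2) * ₂F₁(v, v; 2v; y)`, for `0 ≤ v` and `0 < y < 1`.
For `v = 0` the coefficients of positive order vanish, so that `κ(0, y) = 1`, which is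
also the limit of `κ(v, y)` as `v` decreases to `0`. -/
def lightconeBlock (v y : ℝ) : ℝ :=
  (y / 4) ^ v / Real.sqrt (v + 1) * ordinaryHypergeometric v v (2 * v) y

/-- Exponents and coefficients of a series of lightcone blocks. -/
structure LightconeData (ι : Type*) where
  h : ι → ℝ
  hbar : ι → ℝ
  d : ι → ℝ

namespace LightconeData

variable {ι : Type*} (L : LightconeData ι)

/-- `L` is an expansion with nonnegative coefficients of the correlator `D.G` in lightcone
blocks. With `x = exp w` and `w < 0` real, the identity reads
`g(w, y) = y^(-Δ) * ∑ i, d i * exp ((h i - Δ) * w) * κ(hbar i, y)`; it extends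
to all complex `w` with negative real part by analytic continuation. -/
structure IsExpansionOf (D : CorrelatorData) : Prop where
  h_nonneg : ∀ i, 0 ≤ L.h i
  hbar_nonneg : ∀ i, 0 ≤ L.hbar i
  d_nonneg : ∀ i, 0 ≤ L.d i
  hasSum : ∀ x y : ℝ, 0 < x → x < 1 → 0 < y → y < 1 →
    HasSum
      (fun i => ((y ^ (-D.Δ) * (L.d i * x ^ (L.h i - D.Δ) * lightconeBlock (L.hbar i) y) : ℝ) : ℂ))
      (D.G x y)

/-- The summand `d * exp ((h - Δ) * w)`. -/
def expTerm (Δ : ℝ) (w : ℂ) (i : ι) : ℂ :=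
  (L.d i : ℂ) * Complex.exp (((L.h i - Δ : ℝ) : ℂ) * w)

/-- The coefficient function multiplying `κ(v, y)`: the sum over all labels with `hbar = v`. -/
def f (Δ : ℝ) (v : ℝ) (w : ℂ) : ℂ :=
  ∑' i : {i : ι // L.hbar i = v}, L.expTerm Δ w i

/-- The normalized sum, over the distinct values `v ≤ Λ` of `hbar`, of the functions `f v`. -/
def F (Δ Λ : ℝ) (w : ℂ) : ℂ :=
  ((1 / (2 * Real.sqrt Real.pi) * Λ ^ (-2 * Δ) * Real.Gamma Δ * Real.Gamma (Δ + 1) : ℝ) : ℂ) *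
    ∑' v : {v : ℝ // v ∈ Set.range L.hbar ∧ v ≤ Λ}, L.f Δ v w

/-- The lightcone-block twist density: the sum of `d i • δ_{h i}` over all labels with
`hbar i ≤ Λ`. It is a sum of nonnegative point masses, hence a measure on the real line. -/
def twistDensity (Λ : ℝ) : MeasureTheory.Measure ℝ :=
  MeasureTheory.Measure.sum fun i : {i : ι // L.hbar i ≤ Λ} =>
    ENNReal.ofReal (L.d i) • MeasureTheory.Measure.dirac (L.h i)

end LightconeData

end

/-!
At fixed `x ∈ (0, 1)` the correlator is a sum of lightcone blocks `κ(v i, y)` with nonnegative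
weights `W i = d i * x ^ (h i - Δ)`. Crossing symmetry and the twist gap show that as `y → 1` only
the identity contributes to the crossed channel, so that the sum is asymptotic to
`(1 - x) ^ (-Δ) * (1 - y) ^ (-Δ)` (`tendsto_rpow_mul_tsum_weight_mul_lightconeBlock`). A Tauberian
theorem for the blocks (`tendsto_tsum_weight`) turns this into the asymptotics of the sum of the
weights with `v i ≤ Λ`.

The Tauberian theorem rests on applying Karamata's theorem twice. Write `X = 1 - y`. By Euler's
integral (`ofReal_lightconeBlock`), `κ(v, 1 - X)` is a factor `a(v) → 1 / (2 √π)` times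
`∫ ((1 - X) / ((1 + 1/x) (1 + X x))) ^ v dx / x`, and `1 + t ≈ exp t` compares this, from above
and from below and up to rescalings of `X` by factors close to `1`, with the Bessel kernel
`∫ exp (-X q - v² / q) dq / q`. Blocks with `v < 1` are at most logarithmic in `X`. Hence, with
`N(q) = ∑ i, W i * a(v i) * exp (-v i ² / q)`, the integral `∫ exp (-X q) N(q) dq / q` is
asymptotic to `A X ^ (-Δ)`. Karamata's theorem in `q`, followed by the monotone density theorem
for the increasing function `N`, gives `N(q) ∼ A q ^ Δ / Γ(Δ)`, and Karamata's theorem in the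
variable `v²` gives the sums of the `W i * a(v i)`. The factor `a` is removed by its limit. The
constant `2 √π / (Γ(Δ) Γ(Δ + 1))` is the product of the constants of these steps.

For fixed `Λ`, the weight sums at `x = exp (-p)` are Laplace transforms at `p` of the twist
density. They converge at all `p > 0` to those of the measure with the binomial coefficients of
`(1 - exp (-p)) ^ (-Δ)` as masses at the points `Δ + m`. Taking `p = (k + 1) b` gives the
convergence of all moments of the image under `s ↦ exp (-b s)`, so Weierstrass approximation
(`tendsto_integral_mul_comp_of_moments`) yields the convergence against every function
`exp (-b s) * f (exp (-b s))` with `f` continuous. Both compactly supported functions and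
`exp (s w)` with complex `w`, `re w < 0`, are of this form, so that no analytic continuation in
`w` is needed.
-/

open MeasureTheory Filter Topology Set

/-! ### Limits by approximation, and convergence of moments -/

/-- A function that is, for every `ε`, eventually `ε`-close to one with a limit `ε`-close to `a`,
tends to `a`. -/
theorem tendsto_of_forall_approx {X E : Type*} [PseudoMetricSpace E] {F : Filter X} {u : X → E}
    {a : E}
    (h : ∀ ε > 0, ∃ (u' : X → E) (a' : E), Tendsto u' F (𝓝 a') ∧ dist a' a ≤ ε ∧
      ∀ᶠ i in F, dist (u i) (u' i) ≤ ε) : Tendsto u F (𝓝 a) := by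
  rw [Metric.tendsto_nhds]
  intro ε hε
  obtain ⟨u', a', h1, h2, h3⟩ := h (ε / 4) (by positivity)
  filter_upwards [h3, Metric.tendsto_nhds.1 h1 (ε / 4) (by positivity)] with i h4 h5
  calc dist (u i) a ≤ dist (u i) (u' i) + dist (u' i) a' + dist a' a := dist_triangle4 _ _ _ _
    _ < ε := by linarith

/-- A squeeze lemma: the bounding functions may depend on `ε`, and need only have limits that
are `ε`-close to the common value. -/
theorem tendsto_of_forall_squeeze {X : Type*} {F : Filter X} {u : X → ℝ} {a : ℝ}
    (hlo : ∀ ε > 0, ∃ (lo : X → ℝ) (b : ℝ), Tendsto lo F (𝓝 b) ∧ a - ε < b ∧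
      ∀ᶠ i in F, lo i ≤ u i)
    (hhi : ∀ ε > 0, ∃ (hi : X → ℝ) (b : ℝ), Tendsto hi F (𝓝 b) ∧ b < a + ε ∧
      ∀ᶠ i in F, u i ≤ hi i) : Tendsto u F (𝓝 a) := by
  rw [tendsto_order]
  constructor
  · intro a' ha'
    obtain ⟨lo, b, h1, h2, h3⟩ := hlo (a - a') (by linarith)
    filter_upwards [h3, h1.eventually_const_lt (u := a') (by linarith)] with i h4 h5
    exact h5.trans_le h4
  · intro a' ha'
    obtain ⟨hi, b, h1, h2, h3⟩ := hhi (a' - a) (by linarith)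
    filter_upwards [h3, h1.eventually_lt_const (u := a') (by linarith)] with i h4 h5
    exact h4.trans_lt h5

theorem integrable_mul_comp_of_continuous {Ω : Type*} [MeasurableSpace Ω] {μ : Measure Ω}
    {T : Ω → ℝ} (hT : ∀ᵐ ξ ∂μ, T ξ ∈ Icc (0 : ℝ) 1) (hTi : Integrable T μ) {f : ℝ → ℝ}
    (hf : Continuous f) : Integrable (fun ξ => T ξ * f (T ξ)) μ := by
  obtain ⟨C, hC⟩ := isCompact_Icc.exists_bound_of_continuousOn (s := Icc (0 : ℝ) 1) hf.continuousOn
  refine (hTi.mul_const C).mono' (hTi.1.mul (hf.comp_aestronglyMeasurable hTi.1)) ?_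
  filter_upwards [hT] with ξ hξ
  rw [norm_mul, Real.norm_of_nonneg hξ.1]
  exact mul_le_mul_of_nonneg_left (hC _ hξ) hξ.1

theorem integral_mul_eval_eq_sum {Ω : Type*} [MeasurableSpace Ω] {m : Measure Ω} {U : Ω → ℝ}
    (hU : ∀ᵐ ξ ∂m, U ξ ∈ Icc (0 : ℝ) 1) (hUi : Integrable U m) (p : Polynomial ℝ) :
    ∫ ξ, U ξ * p.eval (U ξ) ∂m =
      ∑ k ∈ Finset.range (p.natDegree + 1), p.coeff k * ∫ ξ, U ξ ^ (k + 1) ∂m := by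
  simp_rw [Polynomial.eval_eq_sum_range, Finset.mul_sum]
  have hk : ∀ k : ℕ, Integrable (fun ξ => U ξ ^ (k + 1)) m := fun k => by
    simpa [pow_succ'] using integrable_mul_comp_of_continuous hU hUi (continuous_pow k)
  rw [integral_finsetSum]
  · refine Finset.sum_congr rfl fun k _ => ?_
    rw [← integral_const_mul]
    congr with ξ
    ring
  · intro k _
    convert (hk k).const_mul (p.coeff k) using 2 with ξ
    ring

theorem abs_integral_mul_comp_sub_le {Ω : Type*} [MeasurableSpace Ω] {m : Measure Ω} {U : Ω → ℝ}
    (hU : ∀ᵐ ξ ∂m, U ξ ∈ Icc (0 : ℝ) 1) (hUi : Integrable U m) {f g : ℝ → ℝ} (hf : Continuous f)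
    (hg : Continuous g) {δ : ℝ} (hp : ∀ x ∈ Icc (0 : ℝ) 1, |g x - f x| < δ) :
    |∫ ξ, U ξ * f (U ξ) ∂m - ∫ ξ, U ξ * g (U ξ) ∂m| ≤ δ * ∫ ξ, U ξ ∂m := by
  rw [← integral_sub (integrable_mul_comp_of_continuous hU hUi hf)
    (integrable_mul_comp_of_continuous hU hUi hg), ← Real.norm_eq_abs,
    ← integral_const_mul]
  refine norm_integral_le_of_norm_le (hUi.const_mul δ) ?_
  filter_upwards [hU] with ξ hξ
  rw [← mul_sub, norm_mul, Real.norm_of_nonneg hξ.1, mul_comm δ, Real.norm_eq_abs, abs_sub_comm]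
  exact mul_le_mul_of_nonneg_left (hp _ hξ).le hξ.1

/-- The method of moments on `[0, 1]`, with Weierstrass approximation: if the weighted moments
`c i * ∫ T i ^ (k + 1)` converge for all `k`, then so do the integrals of `T * f(T)` for
continuous `f`. The factor `T` makes the total mass finite. -/
theorem tendsto_integral_mul_comp_of_moments {X Ω Ω' : Type*} [MeasurableSpace Ω]
    [MeasurableSpace Ω'] {F : Filter X} {μ : X → Measure Ω} {ν : Measure Ω'} {T : X → Ω → ℝ}
    {S : Ω' → ℝ} {c : X → ℝ} (hc : ∀ᶠ i in F, 0 ≤ c i)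
    (hT : ∀ᶠ i in F, ∀ᵐ ξ ∂μ i, T i ξ ∈ Icc (0 : ℝ) 1)
    (hTi : ∀ᶠ i in F, Integrable (T i) (μ i))
    (hS : ∀ᵐ ξ ∂ν, S ξ ∈ Icc (0 : ℝ) 1) (hSi : Integrable S ν)
    (hmom : ∀ k : ℕ, Tendsto (fun i => c i * ∫ ξ, T i ξ ^ (k + 1) ∂μ i) F
      (𝓝 (∫ ξ, S ξ ^ (k + 1) ∂ν))) {f : ℝ → ℝ} (hf : Continuous f) :
    Tendsto (fun i => c i * ∫ ξ, T i ξ * f (T i ξ) ∂μ i) F (𝓝 (∫ ξ, S ξ * f (S ξ) ∂ν)) := by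
  have hM0 : 0 ≤ ∫ ξ, S ξ ∂ν := integral_nonneg_of_ae (hS.mono fun ξ h => h.1)
  have hmass : ∀ᶠ i in F, c i * ∫ ξ, T i ξ ∂μ i ≤ ∫ ξ, S ξ ∂ν + 1 := by
    have := hmom 0
    simp only [zero_add, pow_one] at this
    exact (this.eventually_lt_const (lt_add_one _)).mono fun i h => h.le
  set M := ∫ ξ, S ξ ∂ν + 1 with hM
  refine tendsto_of_forall_approx fun ε hε => ?_
  have hMpos : 0 < M := by positivity
  obtain ⟨p, hp⟩ := exists_polynomial_near_of_continuousOn 0 1 f hf.continuousOn (ε / M)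
    (by positivity)
  refine ⟨fun i => c i * ∫ ξ, T i ξ * p.eval (T i ξ) ∂μ i, ∫ ξ, S ξ * p.eval (S ξ) ∂ν, ?_, ?_, ?_⟩
  · rw [integral_mul_eval_eq_sum hS hSi p]
    have : Tendsto (fun i => ∑ k ∈ Finset.range (p.natDegree + 1),
        p.coeff k * (c i * ∫ ξ, T i ξ ^ (k + 1) ∂μ i)) F
        (𝓝 (∑ k ∈ Finset.range (p.natDegree + 1), p.coeff k * ∫ ξ, S ξ ^ (k + 1) ∂ν)) :=
      tendsto_finsetSum _ fun k _ => (hmom k).const_mul _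
    refine this.congr' ?_
    filter_upwards [hT, hTi] with i h1 h2
    rw [integral_mul_eval_eq_sum h1 h2 p, Finset.mul_sum]
    exact Finset.sum_congr rfl fun k _ => by ring
  · rw [dist_comm, Real.dist_eq]
    refine (abs_integral_mul_comp_sub_le hS hSi hf p.continuous hp).trans ?_
    calc ε / M * ∫ ξ, S ξ ∂ν ≤ ε / M * M := by gcongr; linarith
      _ = ε := by field_simp
  · filter_upwards [hT, hTi, hc, hmass] with i h1 h2 h3 h4
    rw [Real.dist_eq, ← mul_sub, abs_mul, abs_of_nonneg h3]
    calc c i * |_| ≤ c i * (ε / M * ∫ ξ, T i ξ ∂μ i) := by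
          gcongr
          exact abs_integral_mul_comp_sub_le h1 h2 hf p.continuous hp
      _ = ε / M * (c i * ∫ ξ, T i ξ ∂μ i) := by ring
      _ ≤ ε / M * M := by gcongr
      _ = ε := by field_simp

theorem integral_ofReal_mul_comp {Ω : Type*} [MeasurableSpace Ω] {m : Measure Ω} {U : Ω → ℝ}
    (hU : ∀ᵐ ξ ∂m, U ξ ∈ Icc (0 : ℝ) 1) (hUi : Integrable U m) {f : ℝ → ℂ} (hf : Continuous f) :
    ∫ ξ, (U ξ : ℂ) * f (U ξ) ∂m = ((∫ ξ, U ξ * (f (U ξ)).re ∂m : ℝ) : ℂ) +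
      ((∫ ξ, U ξ * (f (U ξ)).im ∂m : ℝ) : ℂ) * Complex.I := by
  have hre := Complex.continuous_re.comp hf
  have him := Complex.continuous_im.comp hf
  have h1 := integrable_mul_comp_of_continuous hU hUi hre
  have h2 := integrable_mul_comp_of_continuous hU hUi him
  simp only [Function.comp_apply] at h1 h2
  rw [← integral_complex_ofReal, ← integral_complex_ofReal, ← integral_mul_const,
    ← integral_add h1.ofReal (h2.ofReal.mul_const _)]
  congr with ξ
  conv_lhs => rw [← Complex.re_add_im (f (U ξ))]
  push_cast
  ring

/-- `tendsto_integral_mul_comp_of_moments` for complex-valued continuous functions. -/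
theorem tendsto_integral_mul_comp_of_moments_complex {X Ω Ω' : Type*} [MeasurableSpace Ω]
    [MeasurableSpace Ω'] {F : Filter X} {μ : X → Measure Ω} {ν : Measure Ω'} {T : X → Ω → ℝ}
    {S : Ω' → ℝ} {c : X → ℝ} (hc : ∀ᶠ i in F, 0 ≤ c i)
    (hT : ∀ᶠ i in F, ∀ᵐ ξ ∂μ i, T i ξ ∈ Icc (0 : ℝ) 1)
    (hTi : ∀ᶠ i in F, Integrable (T i) (μ i))
    (hS : ∀ᵐ ξ ∂ν, S ξ ∈ Icc (0 : ℝ) 1) (hSi : Integrable S ν)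
    (hmom : ∀ k : ℕ, Tendsto (fun i => c i * ∫ ξ, T i ξ ^ (k + 1) ∂μ i) F
      (𝓝 (∫ ξ, S ξ ^ (k + 1) ∂ν))) {f : ℝ → ℂ} (hf : Continuous f) :
    Tendsto (fun i => (c i : ℂ) * ∫ ξ, (T i ξ : ℂ) * f (T i ξ) ∂μ i) F
      (𝓝 (∫ ξ, (S ξ : ℂ) * f (S ξ) ∂ν)) := by
  have hre := Complex.continuous_re.comp hf
  have him := Complex.continuous_im.comp hf
  rw [integral_ofReal_mul_comp hS hSi hf]
  have h1 := tendsto_integral_mul_comp_of_moments hc hT hTi hS hSi hmom hre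
  have h2 := tendsto_integral_mul_comp_of_moments hc hT hTi hS hSi hmom him
  refine ((Complex.continuous_ofReal.continuousAt.tendsto.comp h1).add
    ((Complex.continuous_ofReal.continuousAt.tendsto.comp h2).mul_const Complex.I)).congr' ?_
  filter_upwards [hT, hTi] with i h3 h4
  simp only [Function.comp_apply, integral_ofReal_mul_comp h3 h4 hf]
  push_cast
  ring

/-! ### Karamata's Tauberian theorem and the monotone density theorem -/

/-- The continuous function that is `1` on `(-∞, 1]`, `0` on `[b, ∞)`, and affine between. -/
noncomputable def cutoff (b s : ℝ) : ℝ := max 0 (min 1 ((b - s) / (b - 1)))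

theorem cutoff_nonneg (b s : ℝ) : 0 ≤ cutoff b s := le_max_left _ _

theorem cutoff_le_one (b s : ℝ) : cutoff b s ≤ 1 := max_le zero_le_one (min_le_left _ _)

theorem cutoff_eq_one {b s : ℝ} (hb : 1 < b) (hs : s ≤ 1) : cutoff b s = 1 := by
  have : 1 ≤ (b - s) / (b - 1) := by rw [le_div_iff₀ (by linarith)]; linarith
  simp [cutoff, this]

theorem cutoff_eq_zero {b s : ℝ} (hb : 1 < b) (hs : b ≤ s) : cutoff b s = 0 := by
  have : (b - s) / (b - 1) ≤ 0 := div_nonpos_of_nonpos_of_nonneg (by linarith) (by linarith)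
  exact max_eq_left ((min_le_right _ _).trans this)

theorem continuous_cutoff (b : ℝ) : Continuous (cutoff b) := by
  unfold cutoff
  fun_prop

/-- For `g` vanishing on `[b, ∞)`, the function `f` with `t • f t = g (-log t)` on `(0, 1]`;
cutting `t` off at `exp (-b)` makes it continuous at `0`. -/
noncomputable def expLift {E : Type*} [AddCommGroup E] [Module ℝ E] (g : ℝ → E) (b t : ℝ) : E :=
  (max t (Real.exp (-b)))⁻¹ • g (-Real.log (max t (Real.exp (-b))))

theorem continuous_expLift {E : Type*} [NormedAddCommGroup E] [NormedSpace ℝ E] {g : ℝ → E}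
    (hg : Continuous g) (b : ℝ) : Continuous (expLift g b) := by
  have h : ∀ t, max t (Real.exp (-b)) ≠ 0 := fun t =>
    (lt_max_of_lt_right (Real.exp_pos _)).ne'
  have h1 : Continuous fun t => max t (Real.exp (-b)) := by fun_prop
  exact (h1.inv₀ h).smul (hg.comp (h1.log h).neg)

theorem exp_neg_smul_expLift {E : Type*} [AddCommGroup E] [Module ℝ E] {g : ℝ → E} {b : ℝ}
    (hg : ∀ s, b ≤ s → g s = 0) (s : ℝ) :
    Real.exp (-s) • expLift g b (Real.exp (-s)) = g s := by
  unfold expLift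
  rcases le_total s b with h | h
  · rw [max_eq_left (Real.exp_le_exp.2 (neg_le_neg h)), Real.log_exp, neg_neg, smul_smul,
      mul_inv_cancel₀ (Real.exp_pos _).ne', one_smul]
  · rw [max_eq_right (Real.exp_le_exp.2 (neg_le_neg h)), Real.log_exp, neg_neg,
      hg b le_rfl, hg s h, smul_zero, smul_zero]

theorem exp_neg_mul_expLift_cutoff {b : ℝ} (hb : 1 < b) (s : ℝ) :
    Real.exp (-s) * expLift (cutoff b) b (Real.exp (-s)) = cutoff b s :=
  exp_neg_smul_expLift (fun _ hs => cutoff_eq_zero hb hs) s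

/-- The measure `(C / Γ(α)) s ^ (α - 1) ds` on `(0, ∞)`, with Laplace transform `C X ^ (-α)`. -/
noncomputable def powerMeasure (C α : ℝ) : Measure ℝ :=
  (volume.restrict (Ioi 0)).withDensity fun s => ENNReal.ofReal (C / Real.Gamma α * s ^ (α - 1))

theorem ae_pos_powerMeasure (C α : ℝ) : ∀ᵐ s ∂powerMeasure C α, 0 < s :=
  (withDensity_absolutelyContinuous _ _).ae_le (ae_restrict_mem measurableSet_Ioi)

theorem integral_powerMeasure {C α : ℝ} (hC : 0 ≤ C) (hα : 0 < α) (f : ℝ → ℝ) :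
    ∫ s, f s ∂powerMeasure C α = ∫ s in Ioi 0, C / Real.Gamma α * s ^ (α - 1) * f s := by
  rw [powerMeasure, integral_withDensity_eq_integral_toReal_smul (by fun_prop)
    (ae_of_all _ fun _ => ENNReal.ofReal_lt_top)]
  refine setIntegral_congr_fun measurableSet_Ioi fun s (hs : 0 < s) => ?_
  have := Real.Gamma_pos_of_pos hα
  simp only [smul_eq_mul]
  rw [ENNReal.toReal_ofReal (by positivity)]

theorem integrable_powerMeasure_iff {C α : ℝ} (hC : 0 ≤ C) (hα : 0 < α) (f : ℝ → ℝ) :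
    Integrable f (powerMeasure C α) ↔
      IntegrableOn (fun s => C / Real.Gamma α * s ^ (α - 1) * f s) (Ioi 0) := by
  rw [powerMeasure, integrable_withDensity_iff_integrable_smul' (by fun_prop)
    (ae_of_all _ fun _ => ENNReal.ofReal_lt_top)]
  refine integrableOn_congr_fun (fun s (hs : 0 < s) => ?_) measurableSet_Ioi
  have := Real.Gamma_pos_of_pos hα
  simp only [smul_eq_mul]
  rw [ENNReal.toReal_ofReal (by positivity)]

theorem integral_exp_powerMeasure {C α X : ℝ} (hC : 0 ≤ C) (hα : 0 < α) (hX : 0 < X) :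
    ∫ s, Real.exp (-(X * s)) ∂powerMeasure C α = C * X ^ (-α) := by
  rw [integral_powerMeasure hC hα]
  simp_rw [mul_assoc]
  rw [integral_const_mul, Real.integral_rpow_mul_exp_neg_mul_Ioi hα hX]
  have := (Real.Gamma_pos_of_pos hα).ne'
  rw [Real.rpow_neg hX.le, one_div, Real.inv_rpow hX.le]
  field_simp

theorem integrable_exp_powerMeasure {C α : ℝ} (hC : 0 ≤ C) (hα : 0 < α) :
    Integrable (fun s => Real.exp (-s)) (powerMeasure C α) := by
  rw [integrable_powerMeasure_iff hC hα]
  refine ((Real.GammaIntegral_convergent hα).const_mul (C / Real.Gamma α)).congr ?_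
  exact ae_of_all _ fun s => by ring

theorem powerMeasure_real_Iic {C α b : ℝ} (hC : 0 ≤ C) (hα : 0 < α) (hb : 0 < b) :
    (powerMeasure C α).real (Iic b) = C / Real.Gamma (α + 1) * b ^ α := by
  rw [← integral_indicator_one measurableSet_Iic, integral_powerMeasure hC hα]
  have : ∀ s : ℝ, C / Real.Gamma α * s ^ (α - 1) * (Iic b).indicator 1 s =
      (Iic b).indicator (fun s => C / Real.Gamma α * s ^ (α - 1)) s := fun s => by
    by_cases h : s ∈ Iic b <;> simp [h]
  simp_rw [this]
  rw [setIntegral_indicator measurableSet_Iic, Ioi_inter_Iic, integral_const_mul,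
    ← intervalIntegral.integral_of_le hb.le, integral_rpow (Or.inl (by linarith)),
    Real.Gamma_add_one hα.ne', sub_add_cancel, Real.zero_rpow hα.ne']
  have := (Real.Gamma_pos_of_pos hα).ne'
  field_simp
  ring

theorem integral_cutoff_powerMeasure_bounds {C α b : ℝ} (hC : 0 ≤ C) (hα : 0 < α) (hb : 1 < b) :
    C / Real.Gamma (α + 1) ≤ ∫ s, cutoff b s ∂powerMeasure C α ∧
      ∫ s, cutoff b s ∂powerMeasure C α ≤ C / Real.Gamma (α + 1) * b ^ α := by
  have hg : Integrable (cutoff b) (powerMeasure C α) := by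
    have := integrable_mul_comp_of_continuous (T := fun s => Real.exp (-s)) ?_
      (integrable_exp_powerMeasure hC hα) (continuous_expLift (continuous_cutoff b) b)
    · simpa only [exp_neg_mul_expLift_cutoff hb] using this
    · filter_upwards [ae_pos_powerMeasure C α] with s hs
      exact ⟨(Real.exp_pos _).le, Real.exp_le_one_iff.2 (by linarith)⟩
  have hi : ∀ c : ℝ, Integrable ((Iic c).indicator (1 : ℝ → ℝ)) (powerMeasure C α) := by
    intro c
    refine ((integrable_exp_powerMeasure hC hα).const_mul (Real.exp c)).mono'
      ((measurable_one.indicator measurableSet_Iic).aestronglyMeasurable)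
      (ae_of_all _ fun s => ?_)
    rw [← Real.exp_add]
    by_cases h : s ≤ c
    · simp [h]
    · simpa [h] using (Real.exp_pos _).le
  constructor
  · have := powerMeasure_real_Iic hC hα one_pos
    rw [Real.one_rpow, mul_one, ← integral_indicator_one measurableSet_Iic] at this
    rw [← this]
    refine integral_mono (hi 1) hg fun s => ?_
    by_cases h : s ≤ 1
    · simp [h, cutoff_eq_one hb h]
    · simpa [h] using cutoff_nonneg b s
  · rw [← powerMeasure_real_Iic hC hα (by linarith : 0 < b),
      ← integral_indicator_one measurableSet_Iic]
    refine integral_mono hg (hi b) fun s => ?_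
    by_cases h : s ≤ b
    · simpa [h] using cutoff_le_one b s
    · simp [h, cutoff_eq_zero hb (not_le.1 h).le]

/-- **Karamata's Tauberian theorem**: if the Laplace transform of a positive measure is
asymptotic to `C X ^ (-α)` as `X` decreases to `0`, then the mass of `{s ≤ R}` is asymptotic
to `C R ^ α / Γ(α + 1)`. -/
theorem tendsto_measureReal_of_tendsto_laplace {Ω : Type*} [MeasurableSpace Ω] {μ : Measure Ω}
    {s : Ω → ℝ} (hs : Measurable s) (hs0 : ∀ᵐ ξ ∂μ, 0 ≤ s ξ) {α C : ℝ} (hα : 0 < α)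
    (hint : ∀ X : ℝ, 0 < X → Integrable (fun ξ => Real.exp (-(X * s ξ))) μ)
    (hlim : Tendsto (fun X : ℝ => X ^ α * ∫ ξ, Real.exp (-(X * s ξ)) ∂μ) (𝓝[>] 0) (𝓝 C)) :
    Tendsto (fun R : ℝ => R ^ (-α) * μ.real {ξ | s ξ ≤ R}) atTop
      (𝓝 (C / Real.Gamma (α + 1))) := by
  have hpos : ∀ᶠ X : ℝ in 𝓝[>] 0, 0 < X := self_mem_nhdsWithin
  have hC : 0 ≤ C := ge_of_tendsto hlim <| hpos.mono fun X hX =>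
    mul_nonneg (Real.rpow_nonneg hX.le _) (integral_nonneg fun _ => (Real.exp_pos _).le)
  have hT : ∀ X : ℝ, 0 < X → ∀ᵐ ξ ∂μ, Real.exp (-(X * s ξ)) ∈ Icc (0 : ℝ) 1 := fun X hX => by
    filter_upwards [hs0] with ξ hξ
    exact ⟨(Real.exp_pos _).le, Real.exp_le_one_iff.2 (by have := mul_nonneg hX.le hξ; linarith)⟩
  -- scaling gives all moments of `exp (-X s)`, because `exp (-X s) ^ (k + 1)` is the Laplace
  -- transform at `(k + 1) X`
  have hcut : ∀ b : ℝ, 1 < b → Tendsto (fun X : ℝ => X ^ α * ∫ ξ, cutoff b (X * s ξ) ∂μ) (𝓝[>] 0)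
      (𝓝 (∫ t, cutoff b t ∂powerMeasure C α)) := by
    intro b hb
    have := tendsto_integral_mul_comp_of_moments (F := 𝓝[>] (0 : ℝ)) (μ := fun _ => μ)
      (ν := powerMeasure C α) (T := fun X ξ => Real.exp (-(X * s ξ)))
      (S := fun t => Real.exp (-t)) (c := fun X => X ^ α)
      (hpos.mono fun X hX => Real.rpow_nonneg hX.le _) (hpos.mono hT) (hpos.mono hint)
      (by
        filter_upwards [ae_pos_powerMeasure C α] with t ht
        exact ⟨(Real.exp_pos _).le, Real.exp_le_one_iff.2 (by linarith)⟩)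
      (integrable_exp_powerMeasure hC hα) ?_ (continuous_expLift (continuous_cutoff b) b)
    · simpa only [exp_neg_mul_expLift_cutoff hb] using this
    · intro k
      have hk : (0 : ℝ) < k + 1 := by positivity
      have e1 : ∀ t : ℝ, Real.exp (-t) ^ (k + 1) = Real.exp (-((k + 1) * t)) := fun t => by
        rw [← Real.exp_nat_mul]
        push_cast
        ring_nf
      simp_rw [e1]
      rw [integral_exp_powerMeasure hC hα hk]
      have hsc : Tendsto (fun X : ℝ => (k + 1) * X) (𝓝[>] 0) (𝓝[>] 0) := by
        refine tendsto_nhdsWithin_iff.2 ⟨?_, hpos.mono fun X hX => mul_pos hk hX⟩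
        have : Tendsto (fun X : ℝ => ((k : ℝ) + 1) * X) (𝓝 0) (𝓝 ((k + 1) * 0)) :=
          tendsto_id.const_mul _
        rw [mul_zero] at this
        exact this.mono_left nhdsWithin_le_nhds
      refine ((hlim.comp hsc).mul_const (((k : ℝ) + 1) ^ (-α))).congr' ?_
      filter_upwards [hpos] with X hX
      simp only [Function.comp_apply, ← mul_assoc]
      rw [Real.mul_rpow hk.le hX.le, Real.rpow_neg hk.le]
      field_simp
  have hcuti : ∀ b X : ℝ, 1 < b → 0 < X → Integrable (fun ξ => cutoff b (X * s ξ)) μ := by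
    intro b X hb hX
    have := integrable_mul_comp_of_continuous (hT X hX) (hint X hX)
      (continuous_expLift (continuous_cutoff b) b)
    simpa only [exp_neg_mul_expLift_cutoff hb] using this
  have hmeas : ∀ R, MeasurableSet {ξ | s ξ ≤ R} := fun R => measurableSet_le hs measurable_const
  have hle : ∀ b R : ℝ, 1 < b → 0 < R → ∀ ξ,
      {ξ | s ξ ≤ R}.indicator (1 : Ω → ℝ) ξ ≤ cutoff b (R⁻¹ * s ξ) := by
    intro b R hb hR ξ
    by_cases h : s ξ ≤ R
    · rw [cutoff_eq_one hb (by rw [inv_mul_le_iff₀ hR]; linarith)]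
      simp [h]
    · simpa [h] using cutoff_nonneg b _
  have hindi : ∀ R : ℝ, 0 < R → Integrable ({ξ | s ξ ≤ R}.indicator (1 : Ω → ℝ)) μ := by
    intro R hR
    refine (hcuti 2 R⁻¹ (by norm_num) (by positivity)).mono'
      (measurable_one.indicator (hmeas R)).aestronglyMeasurable (ae_of_all _ fun ξ => ?_)
    rw [Real.norm_of_nonneg (indicator_nonneg (f := (1 : Ω → ℝ)) (fun _ _ => zero_le_one) _)]
    exact hle 2 R (by norm_num) hR ξ
  set c := C / Real.Gamma (α + 1) with hc
  have hpow : Tendsto (fun b : ℝ => c * b ^ α) (𝓝[>] 1) (𝓝 c) := by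
    have : ContinuousAt (fun b : ℝ => c * b ^ α) 1 :=
      (Real.continuousAt_rpow_const 1 α (Or.inl one_ne_zero)).const_mul c
    simpa using this.tendsto.mono_left nhdsWithin_le_nhds
  have hpow' : Tendsto (fun b : ℝ => b ^ (-α) * c) (𝓝[>] 1) (𝓝 c) := by
    have : ContinuousAt (fun b : ℝ => b ^ (-α) * c) 1 :=
      (Real.continuousAt_rpow_const 1 (-α) (Or.inl one_ne_zero)).mul_const c
    simpa using this.tendsto.mono_left nhdsWithin_le_nhds
  have hone : ∀ᶠ b : ℝ in 𝓝[>] 1, 1 < b := self_mem_nhdsWithin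
  -- `cutoff b (b s / R) ≤ 1_{s ≤ R} ≤ cutoff b (s / R)`
  refine tendsto_of_forall_squeeze (fun ε hε => ?_) (fun ε hε => ?_)
  · obtain ⟨b, hb1, hb2⟩ :=
      ((hpow'.eventually_const_lt (u := c - ε) (by linarith)).and hone).exists
    have hX : Tendsto (fun R : ℝ => b / R) atTop (𝓝[>] 0) :=
      tendsto_nhdsWithin_iff.2 ⟨tendsto_const_nhds.div_atTop tendsto_id,
        (eventually_gt_atTop 0).mono fun R hR => div_pos (by linarith) hR⟩
    refine ⟨_, _, ((hcut b hb2).comp hX).const_mul (b ^ (-α)), ?_, ?_⟩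
    · refine hb1.trans_le (mul_le_mul_of_nonneg_left
        (integral_cutoff_powerMeasure_bounds hC hα hb2).1 (by positivity))
    · filter_upwards [eventually_gt_atTop 0] with R hR
      have hb0 : 0 < b := by linarith
      simp only [Function.comp_apply]
      rw [← mul_assoc, Real.div_rpow hb0.le hR.le, Real.rpow_neg hb0.le, Real.rpow_neg hR.le,
        ← integral_indicator_one (hmeas R)]
      have e : (b ^ α)⁻¹ * (b ^ α / R ^ α) = (R ^ α)⁻¹ := by field_simp
      rw [e]
      refine mul_le_mul_of_nonneg_left ?_ (by positivity)
      refine integral_mono (hcuti b _ hb2 (by positivity)) (hindi R hR) fun ξ => ?_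
      by_cases h : s ξ ≤ R
      · simpa [h] using cutoff_le_one b _
      · have : b ≤ b / R * s ξ := by
          rw [div_mul_eq_mul_div, le_div_iff₀ hR]
          exact mul_le_mul_of_nonneg_left (not_le.1 h).le hb0.le
        simp [h, cutoff_eq_zero hb2 this]
  · obtain ⟨b, hb1, hb2⟩ :=
      ((hpow.eventually_lt_const (u := c + ε) (by linarith)).and hone).exists
    have hX : Tendsto (fun R : ℝ => R⁻¹) atTop (𝓝[>] 0) := tendsto_inv_atTop_nhdsGT_zero
    refine ⟨_, _, (hcut b hb2).comp hX,
      (integral_cutoff_powerMeasure_bounds hC hα hb2).2.trans_lt hb1, ?_⟩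
    filter_upwards [eventually_gt_atTop 0] with R hR
    simp only [Function.comp_apply]
    rw [Real.rpow_neg hR.le, Real.inv_rpow hR.le, ← integral_indicator_one (hmeas R)]
    exact mul_le_mul_of_nonneg_left
      (integral_mono (hindi R hR) (hcuti b _ hb2 (by positivity)) (hle b R hb2 hR))
      (by positivity)

/-- The **monotone density theorem** for a logarithmic density: `I` plays the role of
`∫ q in 0..Q, N q / q` with `N` monotone. -/
theorem tendsto_density_of_tendsto_primitive {N I : ℝ → ℝ} {α c : ℝ}
    (hNI : ∀ q q', 0 < q → q < q' → N q * Real.log (q' / q) ≤ I q' - I q ∧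
      I q' - I q ≤ N q' * Real.log (q' / q))
    (hlim : Tendsto (fun Q : ℝ => Q ^ (-α) * I Q) atTop (𝓝 c)) :
    Tendsto (fun q : ℝ => q ^ (-α) * N q) atTop (𝓝 (c * α)) := by
  have hquot : ∀ t : ℝ, Tendsto (fun q : ℝ => q ^ (-α) * ((I (Real.exp t * q) - I q) / t)) atTop
      (𝓝 ((Real.exp (α * t) * c - c) / t)) := by
    intro t
    have h1 : Tendsto (fun q : ℝ => Real.exp t * q) atTop atTop :=
      tendsto_id.const_mul_atTop (Real.exp_pos t)
    refine (((((hlim.comp h1).const_mul (Real.exp (α * t))).sub hlim)).div_const t).congr' ?_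
    filter_upwards [eventually_gt_atTop 0] with q hq
    simp only [Function.comp_apply]
    rw [Real.mul_rpow (Real.exp_pos t).le hq.le, ← Real.exp_mul]
    have e : Real.exp (α * t) * (Real.exp (t * -α) * q ^ (-α) * I (Real.exp t * q)) =
        q ^ (-α) * I (Real.exp t * q) := by
      rw [show t * -α = -(α * t) by ring, Real.exp_neg]
      field_simp
    rw [e]
    ring
  -- negative increments `t` bound `N` from below, positive ones from above; letting `t` tend
  -- to `0` differentiates `exp (α t) * c`
  have hder : Tendsto (fun t : ℝ => (Real.exp (α * t) * c - c) / t) (𝓝[≠] 0) (𝓝 (c * α)) := by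
    have h : HasDerivAt (fun t : ℝ => Real.exp (α * t) * c) (c * α) 0 := by
      have h1 : HasDerivAt (fun t : ℝ => α * t) α 0 := by
        simpa using (hasDerivAt_id (0 : ℝ)).const_mul α
      simpa [mul_comm] using (h1.exp.mul_const c)
    refine h.tendsto_slope.congr fun t => ?_
    simp [slope_def_field]
  refine tendsto_of_forall_squeeze (fun ε hε => ?_) (fun ε hε => ?_)
  · have := (hder.mono_left (nhdsLT_le_nhdsNE 0)).eventually_const_lt
      (u := c * α - ε) (by linarith)
    obtain ⟨t, ht1, ht2⟩ := (this.and (self_mem_nhdsWithin : ∀ᶠ t : ℝ in 𝓝[<] 0, t < 0)).exists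
    refine ⟨_, _, hquot t, ht1, ?_⟩
    filter_upwards [eventually_gt_atTop 0] with q hq
    refine mul_le_mul_of_nonneg_left ?_ (by positivity)
    have h1 : Real.exp t * q < q := by nlinarith [Real.exp_lt_one_iff.2 ht2]
    have := (hNI _ _ (by positivity) h1).2
    rw [show q / (Real.exp t * q) = Real.exp (-t) by rw [Real.exp_neg]; field_simp,
      Real.log_exp] at this
    rw [div_le_iff_of_neg ht2]
    linarith
  · have := (hder.mono_left (nhdsGT_le_nhdsNE 0)).eventually_lt_const
      (u := c * α + ε) (by linarith)
    obtain ⟨t, ht1, ht2⟩ := (this.and (self_mem_nhdsWithin : ∀ᶠ t : ℝ in 𝓝[>] 0, 0 < t)).exists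
    refine ⟨_, _, hquot t, ht1, ?_⟩
    filter_upwards [eventually_gt_atTop 0] with q hq
    refine mul_le_mul_of_nonneg_left ?_ (by positivity)
    have h1 : q < Real.exp t * q := by nlinarith [Real.one_lt_exp_iff.2 ht2]
    have := (hNI _ _ hq h1).1
    rw [show Real.exp t * q / q = Real.exp t by field_simp, Real.log_exp] at this
    rwa [le_div_iff₀ ht2]

/-! ### Lightcone blocks -/

theorem Real.choose_add_natCast_sub_one (a : ℝ) (n : ℕ) :
    Ring.choose (a + n - 1) n = (ascPochhammer ℝ n).eval a / n.factorial := by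
  have := Ring.factorial_nsmul_multichoose_eq_ascPochhammer a n
  rw [Polynomial.ascPochhammer_smeval_eq_eval, nsmul_eq_mul] at this
  rw [← Ring.multichoose_eq, eq_div_iff (by positivity), ← this, mul_comm]

theorem Complex.hasSum_ascPochhammer_mul_pow (a : ℝ) {z : ℂ} (hz : ‖z‖ < 1) :
    HasSum (fun n : ℕ => (((ascPochhammer ℝ n).eval a / n.factorial : ℝ) : ℂ) * z ^ n)
      ((1 - z) ^ (-a : ℂ)) := by
  have h := (Complex.one_div_one_sub_cpow_hasFPowerSeriesOnBall_zero a).hasSum (y := z)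
    (by simpa [enorm_eq_nnnorm, ← NNReal.coe_lt_coe] using hz)
  simp only [zero_add, FormalMultilinearSeries.ofScalars_apply_eq, smul_eq_mul] at h
  rw [Complex.cpow_neg, ← one_div]
  refine h.congr_fun fun n => ?_
  rw [← Real.choose_add_natCast_sub_one, Complex.ofReal_choose]
  push_cast
  rfl

theorem Real.hasSum_ascPochhammer_mul_pow (a : ℝ) {x : ℝ} (hx : |x| < 1) :
    HasSum (fun n : ℕ => (ascPochhammer ℝ n).eval a / n.factorial * x ^ n) ((1 - x) ^ (-a)) := by
  have h := Complex.hasSum_ascPochhammer_mul_pow a (z := x) (by simpa using hx)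
  have hx' : 0 ≤ 1 - x := by linarith [(abs_lt.1 hx).2]
  rw [← Complex.ofReal_neg, ← Complex.ofReal_one, ← Complex.ofReal_sub,
    ← Complex.ofReal_cpow hx'] at h
  exact_mod_cast h

theorem Real.Gamma_add_natCast_eq_mul {a : ℝ} (ha : 0 < a) (n : ℕ) :
    Real.Gamma (a + n) = (ascPochhammer ℝ n).eval a * Real.Gamma a := by
  induction n with
  | zero => simp
  | succ n ih =>
    rw [Nat.cast_succ, ← add_assoc, Real.Gamma_add_one (by positivity), ih,
      ascPochhammer_succ_eval]
    ring

/-- The Taylor coefficients of `₂F₁(v, v; 2v; ·)`. -/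
noncomputable def blockCoeff (v : ℝ) (n : ℕ) : ℝ :=
  (n.factorial : ℝ)⁻¹ * (ascPochhammer ℝ n).eval v * (ascPochhammer ℝ n).eval v *
    ((ascPochhammer ℝ n).eval (2 * v))⁻¹

theorem lightconeBlock_eq_tsum (v y : ℝ) :
    lightconeBlock v y = (y / 4) ^ v / Real.sqrt (v + 1) * ∑' n, blockCoeff v n * y ^ n := by
  rw [lightconeBlock, ordinaryHypergeometric_eq_tsum]
  simp only [smul_eq_mul, blockCoeff]

theorem ascPochhammer_eval_nonneg {v : ℝ} (hv : 0 ≤ v) (n : ℕ) :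
    0 ≤ (ascPochhammer ℝ n).eval v := by
  induction n with
  | zero => simp
  | succ n ih => rw [ascPochhammer_succ_eval]; positivity

theorem blockCoeff_nonneg {v : ℝ} (hv : 0 ≤ v) (n : ℕ) : 0 ≤ blockCoeff v n := by
  have h1 := ascPochhammer_eval_nonneg hv n
  have h2 := ascPochhammer_eval_nonneg (by positivity : 0 ≤ 2 * v) n
  unfold blockCoeff
  positivity

theorem blockCoeff_zero (v : ℝ) : blockCoeff v 0 = 1 := by simp [blockCoeff]

theorem blockCoeff_le {v : ℝ} (hv : 0 ≤ v) (n : ℕ) :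
    blockCoeff v n ≤ (ascPochhammer ℝ n).eval v / n.factorial := by
  have h1 := ascPochhammer_eval_nonneg hv n
  have h2 := ascPochhammer_eval_nonneg (by positivity : 0 ≤ 2 * v) n
  have hle : (ascPochhammer ℝ n).eval v ≤ (ascPochhammer ℝ n).eval (2 * v) := by
    clear h1 h2
    induction n with
    | zero => simp
    | succ n ih =>
      rw [ascPochhammer_succ_eval, ascPochhammer_succ_eval]
      have := ascPochhammer_eval_nonneg (by positivity : 0 ≤ 2 * v) n
      gcongr
      linarith
  have h3 : (ascPochhammer ℝ n).eval v * ((ascPochhammer ℝ n).eval (2 * v))⁻¹ ≤ 1 := by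
    rw [← div_eq_mul_inv]
    exact div_le_one_of_le₀ hle h2
  calc blockCoeff v n = (ascPochhammer ℝ n).eval v / n.factorial *
        ((ascPochhammer ℝ n).eval v * ((ascPochhammer ℝ n).eval (2 * v))⁻¹) := by
        unfold blockCoeff; ring
    _ ≤ _ := mul_le_of_le_one_right (by positivity) h3

theorem summable_blockCoeff_mul_pow {v y : ℝ} (hv : 0 ≤ v) (hy : 0 < y) (hy1 : y < 1) :
    Summable fun n => blockCoeff v n * y ^ n :=
  Summable.of_nonneg_of_le (fun n => mul_nonneg (blockCoeff_nonneg hv n) (by positivity))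
    (fun n => mul_le_mul_of_nonneg_right (blockCoeff_le hv n) (by positivity))
    (Real.hasSum_ascPochhammer_mul_pow v (by rw [abs_of_pos hy]; exact hy1)).summable

theorem le_lightconeBlock {v y : ℝ} (hv : 0 ≤ v) (hy : 0 < y) (hy1 : y < 1) :
    (y / 4) ^ v / Real.sqrt (v + 1) ≤ lightconeBlock v y := by
  rw [lightconeBlock_eq_tsum]
  refine le_mul_of_one_le_right (by positivity) ?_
  have := (summable_blockCoeff_mul_pow hv hy hy1).le_tsum 0
    (fun n _ => mul_nonneg (blockCoeff_nonneg hv n) (by positivity))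
  simpa [blockCoeff_zero] using this

theorem lightconeBlock_pos {v y : ℝ} (hv : 0 ≤ v) (hy : 0 < y) (hy1 : y < 1) :
    0 < lightconeBlock v y :=
  lt_of_lt_of_le (by positivity) (le_lightconeBlock hv hy hy1)

/-- For `v ≤ 1` the coefficients are bounded by those at `v = 1`, because
`(v + k)² / (2v + k)` is increasing in `v`. -/
theorem blockCoeff_le_inv_succ {v : ℝ} (hv : 0 ≤ v) (hv1 : v ≤ 1) (n : ℕ) :
    blockCoeff v n ≤ ((n : ℝ) + 1)⁻¹ := by
  rcases hv.eq_or_lt with rfl | hpos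
  · rcases n with _ | n
    · simp [blockCoeff]
    · have : blockCoeff 0 (n + 1) = 0 := by simp [blockCoeff]
      rw [this]
      positivity
  induction n with
  | zero => simp [blockCoeff]
  | succ n ih =>
    have hrec : blockCoeff v (n + 1) =
        blockCoeff v n * ((v + n) ^ 2 / ((2 * v + n) * (n + 1))) := by
      unfold blockCoeff
      rw [ascPochhammer_succ_eval, ascPochhammer_succ_eval, Nat.factorial_succ]
      push_cast
      have := (ascPochhammer_pos n (2 * v) (by positivity)).ne'
      field_simp
    have hfac : (v + n) ^ 2 / ((2 * v + n) * (n + 1)) ≤ ((n : ℝ) + 1) / (n + 2) := by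
      have hn : (0 : ℝ) ≤ n := n.cast_nonneg
      rw [div_le_div_iff₀ (by positivity) (by positivity)]
      have h1 : 0 ≤ 1 - v := by linarith
      have key : (v + n) ^ 2 * (n + 2) ≤ (n + 1) ^ 2 * (2 * v + n) := by
        have : (n + 1) ^ 2 * (2 * v + n) - (v + n) ^ 2 * ((n : ℝ) + 2) =
            v * (1 - v) * (n + 2) + n * (1 - v) := by ring
        nlinarith [mul_nonneg (mul_nonneg hv h1) (by positivity : (0 : ℝ) ≤ n + 2),
          mul_nonneg hn h1]
      calc _ ≤ (n + 1) ^ 2 * (2 * v + n) := key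
        _ = _ := by ring
    rw [hrec]
    calc _ ≤ ((n : ℝ) + 1)⁻¹ * (((n : ℝ) + 1) / (n + 2)) :=
          mul_le_mul ih hfac (by positivity) (by positivity)
      _ = ((n + 1 : ℕ) + 1 : ℝ)⁻¹ := by
          push_cast
          field_simp
          ring

/-- Blocks with `v ≤ 1` have at most a logarithmic singularity at `y = 1`. -/
theorem lightconeBlock_le_log {v y : ℝ} (hv : 0 ≤ v) (hv1 : v ≤ 1) (hy : 0 < y) (hy1 : y < 1) :
    lightconeBlock v y ≤ -Real.log (1 - y) / y := by
  have h1 : HasSum (fun n : ℕ => ((n : ℝ) + 1)⁻¹ * y ^ n) (-Real.log (1 - y) / y) := by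
    refine ((Real.hasSum_pow_div_log_of_abs_lt_one (x := y)
      (by rw [abs_of_pos hy]; exact hy1)).div_const y).congr_fun fun n => ?_
    rw [pow_succ]
    field_simp
  rw [lightconeBlock_eq_tsum]
  have h2 : (y / 4) ^ v / Real.sqrt (v + 1) ≤ 1 := by
    refine div_le_one_of_le₀ ?_ (Real.sqrt_nonneg _)
    calc (y / 4) ^ v ≤ 1 := Real.rpow_le_one (by positivity) (by linarith) hv
      _ ≤ Real.sqrt (v + 1) := Real.one_le_sqrt.2 (by linarith)
  have h3 : ∑' n, blockCoeff v n * y ^ n ≤ -Real.log (1 - y) / y := by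
    rw [← h1.tsum_eq]
    exact (summable_blockCoeff_mul_pow hv hy hy1).tsum_le_tsum
      (fun n => mul_le_mul_of_nonneg_right (blockCoeff_le_inv_succ hv hv1 n) (by positivity))
      h1.summable
  have h4 : 0 ≤ ∑' n, blockCoeff v n * y ^ n :=
    tsum_nonneg fun n => mul_nonneg (blockCoeff_nonneg hv n) (by positivity)
  calc _ ≤ 1 * ∑' n, blockCoeff v n * y ^ n := mul_le_mul_of_nonneg_right h2 h4
    _ ≤ _ := by rwa [one_mul]

/-! ### Euler's integral for the blocks -/

/-- The factor in front of Euler's integral for `κ(v, ·)`. -/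
noncomputable def blockWeight (v : ℝ) : ℝ :=
  Real.Gamma (2 * v) / (Real.Gamma v ^ 2 * 4 ^ v * Real.sqrt (v + 1))

theorem blockWeight_pos {v : ℝ} (hv : 0 < v) : 0 < blockWeight v := by
  have h1 := Real.Gamma_pos_of_pos hv
  have h2 := Real.Gamma_pos_of_pos (by positivity : 0 < 2 * v)
  unfold blockWeight
  positivity

theorem Real.Gamma_add_half_le {u : ℝ} (hu : 0 < u) :
    Real.Gamma (u + 1 / 2) ≤ Real.Gamma u * Real.sqrt u := by
  have h := Real.Gamma_mul_add_mul_le_rpow_Gamma_mul_rpow_Gamma hu (by positivity : 0 < u + 1)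
    (by norm_num : (0 : ℝ) < 1 / 2) (by norm_num : (0 : ℝ) < 1 / 2) (by norm_num)
  have hG := Real.Gamma_pos_of_pos hu
  rw [Real.Gamma_add_one hu.ne', ← Real.sqrt_eq_rpow, ← Real.sqrt_eq_rpow,
    Real.sqrt_mul hu.le] at h
  calc Real.Gamma (u + 1 / 2) = Real.Gamma (1 / 2 * u + 1 / 2 * (u + 1)) := by ring_nf
    _ ≤ _ := h
    _ = (√(Real.Gamma u) * √(Real.Gamma u)) * √u := by ring
    _ = _ := by rw [Real.mul_self_sqrt hG.le]

theorem tendsto_blockWeight :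
    Tendsto blockWeight atTop (𝓝 (1 / (2 * Real.sqrt Real.pi))) := by
  have hpi : 0 < Real.sqrt Real.pi := Real.sqrt_pos.2 Real.pi_pos
  have hform : ∀ v : ℝ, 0 < v → blockWeight v =
      1 / (2 * Real.sqrt Real.pi) *
        (Real.Gamma (v + 1 / 2) / Real.Gamma v / Real.sqrt (v + 1)) := by
    intro v hv
    have hG := (Real.Gamma_pos_of_pos hv).ne'
    have hdup := Real.Gamma_mul_Gamma_add_half v
    have h4 : (2 : ℝ) ^ (1 - 2 * v) * 4 ^ v = 2 := by
      rw [show (4 : ℝ) = 2 ^ (2 : ℝ) by norm_num, ← Real.rpow_mul (by norm_num),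
        ← Real.rpow_add (by norm_num)]
      simp
    have h4' : (2 : ℝ) ^ (1 - 2 * v) = 2 / 4 ^ v := by
      rw [eq_div_iff (by positivity)]; exact h4
    rw [h4'] at hdup
    have hs : 0 < Real.sqrt (v + 1) := Real.sqrt_pos.2 (by linarith)
    have h4p : (0 : ℝ) < 4 ^ v := by positivity
    have : Real.Gamma (2 * v) =
        Real.Gamma v * Real.Gamma (v + 1 / 2) * 4 ^ v / (2 * Real.sqrt Real.pi) := by
      rw [hdup]
      field_simp
    rw [blockWeight, this]
    field_simp
  have hlo : Tendsto (fun v : ℝ => Real.sqrt ((v - 1 / 2) / (v + 1))) atTop (𝓝 1) := by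
    have : Tendsto (fun v : ℝ => 1 - (3 / 2) / (v + 1)) atTop (𝓝 (1 - 0)) :=
      tendsto_const_nhds.sub
        (tendsto_const_nhds.div_atTop (tendsto_id.atTop_add tendsto_const_nhds))
    rw [sub_zero] at this
    have h := (Real.continuous_sqrt.tendsto 1).comp this
    rw [Real.sqrt_one] at h
    refine h.congr' ?_
    filter_upwards [eventually_gt_atTop 0] with v hv
    simp only [Function.comp_apply]
    congr 1
    field_simp
    ring
  have hmid : Tendsto (fun v : ℝ => Real.Gamma (v + 1 / 2) / Real.Gamma v / Real.sqrt (v + 1))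
      atTop (𝓝 1) := by
    refine tendsto_of_tendsto_of_tendsto_of_le_of_le' hlo tendsto_const_nhds ?_ ?_
    · filter_upwards [eventually_gt_atTop 1] with v hv
      have hG := Real.Gamma_pos_of_pos (by linarith : 0 < v)
      have hu : 0 < v - 1 / 2 := by linarith
      have h := Real.Gamma_add_half_le hu
      have h2 := Real.Gamma_add_one hu.ne'
      rw [sub_add_cancel] at h
      rw [show v - 1 / 2 + 1 = v + 1 / 2 by ring] at h2
      rw [Real.sqrt_div hu.le]
      refine div_le_div_of_nonneg_right ?_ (Real.sqrt_nonneg _)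
      rw [le_div_iff₀ hG, h2]
      calc √(v - 1 / 2) * Real.Gamma v
          ≤ √(v - 1 / 2) * (Real.Gamma (v - 1 / 2) * √(v - 1 / 2)) := by gcongr
        _ = (√(v - 1 / 2) * √(v - 1 / 2)) * Real.Gamma (v - 1 / 2) := by ring
        _ = _ := by rw [Real.mul_self_sqrt hu.le]
    · filter_upwards [eventually_gt_atTop 0] with v hv
      have hG := Real.Gamma_pos_of_pos hv
      rw [div_div]
      refine div_le_one_of_le₀ ((Real.Gamma_add_half_le hv).trans ?_) (by positivity)
      gcongr
      linarith
  have := hmid.const_mul (1 / (2 * Real.sqrt Real.pi))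
  rw [mul_one] at this
  refine this.congr' ?_
  filter_upwards [eventually_gt_atTop 0] with v hv
  rw [hform v hv]

theorem lintegral_rpow_mul_one_sub_rpow {p r : ℝ} (hp : 0 < p) (hr : 0 < r) :
    ∫⁻ t in Ioo (0 : ℝ) 1, ENNReal.ofReal (t ^ (p - 1) * (1 - t) ^ (r - 1)) =
      ENNReal.ofReal (ProbabilityTheory.beta p r) := by
  have hb := ProbabilityTheory.beta_pos hp hr
  have h := ProbabilityTheory.lintegral_betaPDF_eq_one hp hr
  rw [ProbabilityTheory.lintegral_betaPDF] at h
  simp_rw [mul_assoc] at h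
  simp_rw [ENNReal.ofReal_mul (by positivity : 0 ≤ 1 / ProbabilityTheory.beta p r)] at h
  rw [lintegral_const_mul _ (by fun_prop)] at h
  calc _ = ENNReal.ofReal (ProbabilityTheory.beta p r * (1 / ProbabilityTheory.beta p r)) *
        ∫⁻ t in Ioo (0 : ℝ) 1, ENNReal.ofReal (t ^ (p - 1) * (1 - t) ^ (r - 1)) := by
        rw [mul_one_div_cancel hb.ne', ENNReal.ofReal_one, one_mul]
    _ = _ := by rw [ENNReal.ofReal_mul hb.le, mul_assoc, h, mul_one]

theorem lintegral_rpow_mul_one_add_rpow {p r : ℝ} (hp : 0 < p) (hr : 0 < r) :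
    ∫⁻ x in Ioi (0 : ℝ), ENNReal.ofReal (x ^ (p - 1) * (1 + x) ^ (-(p + r))) =
      ENNReal.ofReal (ProbabilityTheory.beta p r) := by
  have himg : (fun t : ℝ => t / (1 - t)) '' Ioo 0 1 = Ioi 0 := by
    ext x
    constructor
    · rintro ⟨t, ⟨h0, h1⟩, rfl⟩
      exact div_pos h0 (by linarith)
    · intro (hx : 0 < x)
      refine ⟨x / (1 + x), ⟨by positivity, (div_lt_one (by positivity)).2 (by linarith)⟩, ?_⟩
      simp only
      field_simp
      ring
  have hinj : InjOn (fun t : ℝ => t / (1 - t)) (Ioo 0 1) := by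
    intro s hs t ht h
    have h1 : 1 - s ≠ 0 := by linarith [hs.2]
    have h2 : 1 - t ≠ 0 := by linarith [ht.2]
    simp only [div_eq_div_iff h1 h2] at h
    linarith
  have hder : ∀ t ∈ Ioo (0 : ℝ) 1,
      HasDerivWithinAt (fun t : ℝ => t / (1 - t)) (1 / (1 - t) ^ 2) (Ioo 0 1) t := by
    intro t ht
    have h1 : 1 - t ≠ 0 := by linarith [ht.2]
    have := (hasDerivAt_id t).div ((hasDerivAt_id t).const_sub 1) h1
    refine (this.congr_deriv ?_).hasDerivWithinAt
    simp
  rw [← lintegral_rpow_mul_one_sub_rpow hp hr, ← himg,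
    lintegral_image_eq_lintegral_abs_deriv_mul measurableSet_Ioo hder hinj]
  refine setLIntegral_congr_fun measurableSet_Ioo fun t ht => ?_
  have h0 : 0 < t := ht.1
  have h1 : 0 < 1 - t := by linarith [ht.2]
  rw [← ENNReal.ofReal_mul (abs_nonneg _), abs_of_pos (by positivity)]
  congr 1
  have e1 : 1 + t / (1 - t) = (1 - t)⁻¹ := by field_simp; ring
  rw [e1, Real.inv_rpow h1.le, Real.rpow_neg h1.le, inv_inv, Real.div_rpow h0.le h1.le]
  have e2 : (1 - t) ^ (p + r) = (1 - t) ^ (r - 1) * (1 - t) ^ (p - 1) * (1 - t) ^ 2 := by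
    rw [← Real.rpow_natCast, ← Real.rpow_add h1, ← Real.rpow_add h1]
    congr 1
    push_cast
    ring
  rw [e2]
  field_simp

/-- The base of the power in Euler's integral for the blocks, at `y = 1 - X`. -/
noncomputable def eulerBase (X x : ℝ) : ℝ := (1 - X) / ((1 + 1 / x) * (1 + X * x))

theorem eulerBase_pos {X x : ℝ} (hX : 0 < X) (hX1 : X < 1) (hx : 0 < x) : 0 < eulerBase X x := by
  have : 0 < 1 - X := by linarith
  unfold eulerBase
  positivity

/-- Euler's integral `κ(v, 1 - X) = a(v) ∫ x in 0..∞, (eulerBase X x) ^ v dx / x`, from the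
binomial series and the beta integral. -/
theorem ofReal_lightconeBlock {v X : ℝ} (hv : 0 < v) (hX : 0 < X) (hX1 : X < 1) :
    ENNReal.ofReal (lightconeBlock v (1 - X)) = ENNReal.ofReal (blockWeight v) *
      ∫⁻ x in Ioi (0 : ℝ), ENNReal.ofReal (eulerBase X x ^ v / x) := by
  set y := 1 - X with hy
  have hy0 : 0 < y := by linarith
  have hy1 : y < 1 := by linarith
  have hG := Real.Gamma_pos_of_pos hv
  have hG2 := Real.Gamma_pos_of_pos (by positivity : 0 < 2 * v)
  have hasc := fun n => ascPochhammer_eval_nonneg hv.le n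
  have hterm : ∀ x ∈ Ioi (0 : ℝ), ENNReal.ofReal (eulerBase X x ^ v / x) =
      ∑' n : ℕ, ENNReal.ofReal (y ^ v * ((ascPochhammer ℝ n).eval v / n.factorial * y ^ n)) *
        ENNReal.ofReal (x ^ (v + n - 1) * (1 + x) ^ (-(v + n + v))) := by
    intro x (hx : 0 < x)
    have hx1 : 0 < 1 + x := by linarith
    have ht0 : 0 < y * (x / (1 + x)) := by positivity
    have ht1 : y * (x / (1 + x)) < 1 := by
      rw [mul_div_assoc', div_lt_one hx1]; nlinarith
    have hs := (Real.hasSum_ascPochhammer_mul_pow v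
      (x := y * (x / (1 + x))) (by rw [abs_of_pos ht0]; exact ht1)).mul_left
      (y ^ v * x ^ (v - 1) * (1 + x) ^ (-(2 * v)))
    have hval : eulerBase X x ^ v / x =
        y ^ v * x ^ (v - 1) * (1 + x) ^ (-(2 * v)) * (1 - y * (x / (1 + x))) ^ (-v) := by
      have e1 : eulerBase X x = y * x * ((1 + x) ^ 2)⁻¹ * (1 - y * (x / (1 + x)))⁻¹ := by
        have : 1 - y * (x / (1 + x)) = (1 + X * x) / (1 + x) := by
          rw [hy]; field_simp; ring
        rw [this, eulerBase, ← hy]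
        field_simp
        ring
      have h1 : 0 < 1 - y * (x / (1 + x)) := by linarith
      rw [e1, Real.mul_rpow (by positivity) (by positivity),
        Real.mul_rpow (by positivity) (by positivity), Real.mul_rpow hy0.le hx.le,
        Real.inv_rpow h1.le, Real.rpow_neg h1.le, Real.inv_rpow (by positivity),
        Real.rpow_neg hx1.le, Real.rpow_mul hx1.le, Real.rpow_two, Real.rpow_sub_one hx.ne']
      ring
    rw [hval, ← hs.tsum_eq, ENNReal.ofReal_tsum_of_nonneg _ hs.summable]
    · refine tsum_congr fun n => ?_
      rw [← ENNReal.ofReal_mul (by have := hasc n; positivity)]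
      congr 1
      rw [show v + n - 1 = (v - 1) + n by ring, Real.rpow_add hx, Real.rpow_natCast,
        show -(v + n + v) = -(2 * v) - n by ring, Real.rpow_sub hx1, Real.rpow_natCast]
      rw [mul_pow, div_pow]
      ring
    · intro n
      have := hasc n
      positivity
  rw [setLIntegral_congr_fun measurableSet_Ioi hterm, lintegral_tsum (fun n => by fun_prop)]
  have hint : ∀ n : ℕ, ∫⁻ x in Ioi (0 : ℝ),
      ENNReal.ofReal (y ^ v * ((ascPochhammer ℝ n).eval v / n.factorial * y ^ n)) *
        ENNReal.ofReal (x ^ (v + n - 1) * (1 + x) ^ (-(v + n + v))) =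
      ENNReal.ofReal
        (y ^ v * Real.Gamma v ^ 2 / Real.Gamma (2 * v) * (blockCoeff v n * y ^ n)) := by
    intro n
    rw [lintegral_const_mul _ (by fun_prop), lintegral_rpow_mul_one_add_rpow (by positivity) hv,
      ← ENNReal.ofReal_mul (by have := hasc n; positivity)]
    congr 1
    rw [ProbabilityTheory.beta, show v + n + v = 2 * v + n by ring,
      Real.Gamma_add_natCast_eq_mul hv, Real.Gamma_add_natCast_eq_mul (by positivity : 0 < 2 * v),
      blockCoeff]
    have := (ascPochhammer_pos n (2 * v) (by positivity)).ne'
    field_simp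
  simp_rw [hint]
  have hsum := summable_blockCoeff_mul_pow hv.le hy0 hy1
  rw [← ENNReal.ofReal_tsum_of_nonneg
    (fun n => mul_nonneg (by positivity) (mul_nonneg (blockCoeff_nonneg hv.le n) (by positivity)))
    (hsum.mul_left _), tsum_mul_left, ← ENNReal.ofReal_mul (blockWeight_pos hv).le]
  congr 1
  rw [lightconeBlock_eq_tsum, Real.div_rpow hy0.le (by norm_num), blockWeight]
  have h4p : (0 : ℝ) < 4 ^ v := by positivity
  have hs : 0 < Real.sqrt (v + 1) := Real.sqrt_pos.2 (by linarith)
  field_simp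

/-! ### Comparison of the blocks with a Bessel kernel -/

/-- The kernel `∫ q in 0..∞, exp(-X q - σ / q) dq / q`, equal to `2 K₀(2 √(σ X))`. It is a
Laplace transform in `σ` and in `X`. -/
noncomputable def besselKernel (σ X : ℝ) : ENNReal :=
  ∫⁻ q in Ioi (0 : ℝ), ENNReal.ofReal (Real.exp (-(X * q) - σ / q) / q)

theorem besselKernel_anti {σ X Y : ℝ} (h : X ≤ Y) : besselKernel σ Y ≤ besselKernel σ X := by
  refine setLIntegral_mono' measurableSet_Ioi fun q (hq : 0 < q) => ?_
  refine ENNReal.ofReal_le_ofReal ?_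
  gcongr

theorem lintegral_exp_eq_besselKernel {v c X : ℝ} (hv : 0 < v) (hc : 0 < c) :
    ∫⁻ x in Ioi (0 : ℝ), ENNReal.ofReal (Real.exp (-(c * v * (1 / x + X * x))) / x) =
      besselKernel (v ^ 2) (c ^ 2 * X) := by
  have hk : 0 < v / c := by positivity
  have himg : (fun x : ℝ => v / c * x) '' Ioi 0 = Ioi 0 := by
    rw [image_mul_left_Ioi hk, mul_zero]
  have hder : ∀ t ∈ Ioi (0 : ℝ), HasDerivWithinAt (fun x : ℝ => v / c * x) (v / c) (Ioi 0) t :=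
    fun t _ => by simpa using ((hasDerivAt_id t).const_mul (v / c)).hasDerivWithinAt
  rw [besselKernel]
  conv_rhs => rw [← himg]
  rw [lintegral_image_eq_lintegral_abs_deriv_mul measurableSet_Ioi hder
      (fun a _ b _ h => mul_left_cancel₀ hk.ne' h)]
  refine setLIntegral_congr_fun measurableSet_Ioi fun x (hx : 0 < x) => ?_
  rw [← ENNReal.ofReal_mul (abs_nonneg _), abs_of_pos hk]
  congr 1
  have e : -(c ^ 2 * X * (v / c * x)) - v ^ 2 / (v / c * x) = -(c * v * (1 / x + X * x)) := by
    field_simp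
    ring
  rw [e]
  field_simp

/-- For all `q`, the part of the kernel integral over `(q, 2q]` gives a lower bound. -/
theorem le_besselKernel {σ X q : ℝ} (hσ : 0 ≤ σ) (hX : 0 ≤ X) (hq : 0 < q) :
    ENNReal.ofReal (Real.exp (-(2 * X * q) - σ / q) / 2) ≤ besselKernel σ X := by
  calc ENNReal.ofReal (Real.exp (-(2 * X * q) - σ / q) / 2)
      = ∫⁻ _ in Ioc q (2 * q), ENNReal.ofReal (Real.exp (-(2 * X * q) - σ / q) / (2 * q)) := by
        rw [setLIntegral_const, Real.volume_Ioc, ← ENNReal.ofReal_mul (by positivity)]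
        congr 1
        field_simp
        ring
    _ ≤ ∫⁻ s in Ioc q (2 * q), ENNReal.ofReal (Real.exp (-(X * s) - σ / s) / s) := by
        refine setLIntegral_mono' measurableSet_Ioc fun s hs => ENNReal.ofReal_le_ofReal ?_
        have hs0 : 0 < s := hq.trans hs.1
        have h1 : X * s ≤ 2 * X * q := by nlinarith [hs.2]
        have h2 : σ / s ≤ σ / q := div_le_div_of_nonneg_left hσ hq hs.1.le
        have h3 := hs.2
        gcongr
    _ ≤ _ := lintegral_mono_set fun s hs => hq.trans hs.1

theorem exp_le_eulerBase {X x : ℝ} (hX : 0 < X) (hX1 : X ≤ 1 / 2) (hx : 0 < x) :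
    Real.exp (-((1 + Real.sqrt X) * (1 / x + X * x))) ≤ eulerBase X x := by
  set r := Real.sqrt X with hr
  have hr0 : 0 < r := Real.sqrt_pos.2 hX
  have hrX : r ^ 2 = X := Real.sq_sqrt hX.le
  have hamgm : 2 * r ≤ 1 / x + X * x := by
    have : 1 / x + X * x - 2 * r = (1 - r * x) ^ 2 / x := by
      rw [← hrX]; field_simp; ring
    have h2 : 0 ≤ (1 - r * x) ^ 2 / x := by positivity
    linarith
  -- the factor `1 - X` is absorbed by the arithmetic-geometric mean inequality
  have h1 : Real.exp (-(r * (1 / x + X * x))) ≤ 1 - X := by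
    calc Real.exp (-(r * (1 / x + X * x))) ≤ Real.exp (-(2 * X)) := by
          rw [Real.exp_le_exp]; nlinarith
      _ = 1 / Real.exp (2 * X) := by rw [Real.exp_neg, one_div]
      _ ≤ 1 / (2 * X + 1) := one_div_le_one_div_of_le (by positivity) (Real.add_one_le_exp _)
      _ ≤ 1 - X := by
          rw [div_le_iff₀ (by positivity)]
          nlinarith
  have h2 : (1 + 1 / x) * (1 + X * x) ≤ Real.exp (1 / x + X * x) := by
    rw [Real.exp_add]
    have e1 := Real.add_one_le_exp (1 / x)
    have e2 := Real.add_one_le_exp (X * x)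
    have : 0 ≤ X * x := by positivity
    exact mul_le_mul (by linarith) (by linarith) (by linarith) (Real.exp_pos _).le
  have h3 : Real.exp (-((1 + r) * (1 / x + X * x))) =
      Real.exp (-(r * (1 / x + X * x))) / Real.exp (1 / x + X * x) := by
    rw [← Real.exp_sub]; congr 1; ring
  rw [h3, eulerBase]
  exact div_le_div₀ (by linarith) h1 (by positivity) h2

theorem besselKernel_le_lightconeBlock {v X : ℝ} (hv : 0 < v) (hX : 0 < X) (hX1 : X ≤ 1 / 2) :
    ENNReal.ofReal (blockWeight v) * besselKernel (v ^ 2) ((1 + Real.sqrt X) ^ 2 * X) ≤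
      ENNReal.ofReal (lightconeBlock v (1 - X)) := by
  rw [ofReal_lightconeBlock hv hX (by linarith),
    ← lintegral_exp_eq_besselKernel hv (by positivity)]
  gcongr ENNReal.ofReal (blockWeight v) * ?_
  refine setLIntegral_mono' measurableSet_Ioi fun x (hx : 0 < x) => ENNReal.ofReal_le_ofReal ?_
  refine div_le_div_of_nonneg_right ?_ hx.le
  calc Real.exp (-((1 + √X) * v * (1 / x + X * x)))
      = Real.exp (-((1 + √X) * (1 / x + X * x))) ^ v := by
        rw [← Real.exp_mul]; congr 1; ring
    _ ≤ _ := Real.rpow_le_rpow (Real.exp_pos _).le (exp_le_eulerBase hX hX1 hx) hv.le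

theorem exp_le_one_add {η z : ℝ} (hη : 0 < η) (hη1 : η < 1) (hz : 0 ≤ z) (hzη : z ≤ η) :
    Real.exp ((1 - η) * z) ≤ 1 + z := by
  have h1 : 0 < 1 - (1 - η) * z := by nlinarith
  have h2 := Real.add_one_le_exp (-((1 - η) * z))
  have h3 : Real.exp ((1 - η) * z) ≤ 1 / (1 - (1 - η) * z) := by
    rw [le_div_iff₀ h1]
    calc Real.exp ((1 - η) * z) * (1 - (1 - η) * z)
        ≤ Real.exp ((1 - η) * z) * Real.exp (-((1 - η) * z)) := by gcongr; linarith
      _ = 1 := by rw [← Real.exp_add]; simp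
  refine h3.trans ?_
  rw [div_le_iff₀ h1]
  nlinarith [mul_nonneg hz hη.le, mul_nonneg hz (by nlinarith : 0 ≤ η - (1 - η) * z)]

/-- The integrand of Euler's integral is at most that of the rescaled kernel where
`1 / x, X x ≤ η`, and is exponentially small in `v` elsewhere. -/
theorem eulerBase_rpow_le {η v X x : ℝ} (hη : 0 < η) (hη1 : η < 1) (hv : 1 ≤ v) (hX : 0 < X)
    (hX1 : X < 1) (hx : 0 < x) :
    eulerBase X x ^ v ≤ Real.exp (-((1 - η) * v * (1 / x + X * x))) +
      (1 + η) ^ (1 - v) * eulerBase X x := by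
  have hB := eulerBase_pos hX hX1 hx
  by_cases h : 1 / x ≤ η ∧ X * x ≤ η
  · have h1 : eulerBase X x ≤ Real.exp (-((1 - η) * (1 / x + X * x))) := by
      rw [eulerBase, Real.exp_neg, ← one_div]
      have e1 := exp_le_one_add hη hη1 (by positivity) h.1
      have e2 := exp_le_one_add hη hη1 (by positivity) h.2
      refine div_le_div₀ zero_le_one (by linarith) (Real.exp_pos _) ?_
      rw [mul_add, Real.exp_add]
      gcongr
    calc eulerBase X x ^ v ≤ Real.exp (-((1 - η) * (1 / x + X * x))) ^ v :=
          Real.rpow_le_rpow hB.le h1 (by linarith)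
      _ = Real.exp (-((1 - η) * v * (1 / x + X * x))) := by
          rw [← Real.exp_mul]; congr 1; ring
      _ ≤ _ := by
          have : 0 ≤ (1 + η) ^ (1 - v) * eulerBase X x := by positivity
          linarith
  · have h1 : 1 + η ≤ (1 + 1 / x) * (1 + X * x) := by
      have p1 : 0 < 1 / x := by positivity
      have p2 : 0 < X * x := by positivity
      rw [not_and_or, not_le, not_le] at h
      rcases h with h | h <;> nlinarith [mul_pos p1 p2]
    have h2 : eulerBase X x ≤ (1 + η)⁻¹ := by
      rw [eulerBase, ← one_div]
      exact div_le_div₀ zero_le_one (by linarith) (by positivity) h1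
    calc eulerBase X x ^ v = eulerBase X x ^ (v - 1) * eulerBase X x := by
          rw [← Real.rpow_add_one hB.ne']; ring_nf
      _ ≤ (1 + η)⁻¹ ^ (v - 1) * eulerBase X x := by
          gcongr
      _ = (1 + η) ^ (1 - v) * eulerBase X x := by
          rw [Real.inv_rpow (by positivity), ← Real.rpow_neg (by positivity), neg_sub]
      _ ≤ _ := by linarith [Real.exp_pos (-((1 - η) * v * (1 / x + X * x)))]

theorem lightconeBlock_le_besselKernel {η v X : ℝ} (hη : 0 < η) (hη1 : η < 1) (hv : 1 ≤ v)
    (hX : 0 < X) (hX1 : X < 1) :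
    ENNReal.ofReal (lightconeBlock v (1 - X)) ≤
      ENNReal.ofReal (blockWeight v) * besselKernel (v ^ 2) ((1 - η) ^ 2 * X) +
      ENNReal.ofReal (blockWeight v * (1 + η) ^ (1 - v)) *
        ENNReal.ofReal (lightconeBlock 1 (1 - X) / blockWeight 1) := by
  have hv0 : 0 < v := by linarith
  have hw1 := blockWeight_pos one_pos
  have h1 : ENNReal.ofReal (lightconeBlock 1 (1 - X) / blockWeight 1) =
      ∫⁻ x in Ioi (0 : ℝ), ENNReal.ofReal (eulerBase X x / x) := by
    have := ofReal_lightconeBlock one_pos hX hX1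
    simp only [Real.rpow_one] at this
    rw [ENNReal.ofReal_div_of_pos hw1, this, mul_comm, mul_div_assoc]
    rw [ENNReal.div_self (by simpa using hw1) ENNReal.ofReal_ne_top, mul_one]
  rw [h1, ofReal_lightconeBlock hv0 hX hX1,
    ← lintegral_exp_eq_besselKernel hv0 (by linarith : 0 < 1 - η),
    ENNReal.ofReal_mul (blockWeight_pos hv0).le, mul_assoc, ← mul_add,
    ← lintegral_const_mul' (ENNReal.ofReal ((1 + η) ^ (1 - v))) _ ENNReal.ofReal_ne_top]
  gcongr ENNReal.ofReal (blockWeight v) * ?_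
  rw [← lintegral_add_left (by fun_prop)]
  refine setLIntegral_mono' measurableSet_Ioi fun x (hx : 0 < x) => ?_
  have hB := eulerBase_pos hX hX1 hx
  rw [← ENNReal.ofReal_mul (by positivity), ← ENNReal.ofReal_add (by positivity) (by positivity)]
  refine ENNReal.ofReal_le_ofReal ?_
  rw [mul_div_assoc', ← add_div]
  exact div_le_div_of_nonneg_right (eulerBase_rpow_le hη hη1 hv hX hX1 hx) hx.le

/-! ### Discrete measures -/

theorem integrable_sum_smul_dirac {κ E : Type*} [NormedAddCommGroup E] {c x : κ → ℝ}
    (hc : ∀ i, 0 ≤ c i) {f : ℝ → E} (hf : StronglyMeasurable f)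
    (h : Summable fun i => c i * ‖f (x i)‖) :
    Integrable f (Measure.sum fun i => ENNReal.ofReal (c i) • Measure.dirac (x i)) := by
  refine ⟨hf.aestronglyMeasurable, ?_⟩
  rw [HasFiniteIntegral, lintegral_sum_measure]
  convert h.tsum_ofReal_lt_top using 3 with i
  rw [lintegral_smul_measure, lintegral_dirac' _ hf.enorm, ENNReal.ofReal_mul (hc i),
    ofReal_norm, smul_eq_mul]

theorem hasSum_integral_sum_smul_dirac {κ E : Type*} [NormedAddCommGroup E] [NormedSpace ℝ E]
    [CompleteSpace E] {c x : κ → ℝ} (hc : ∀ i, 0 ≤ c i) {f : ℝ → E} (hf : StronglyMeasurable f)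
    (hint : Integrable f (Measure.sum fun i => ENNReal.ofReal (c i) • Measure.dirac (x i))) :
    HasSum (fun i => c i • f (x i))
      (∫ s, f s ∂(Measure.sum fun i => ENNReal.ofReal (c i) • Measure.dirac (x i))) := by
  convert hasSum_integral_measure hint using 2 with i
  rw [integral_smul_measure, integral_dirac' _ _ hf, ENNReal.toReal_ofReal (hc i)]

theorem ae_nonneg_sum_smul_dirac {κ : Type*} {c x : κ → ℝ} (hx : ∀ i, 0 ≤ x i) :
    ∀ᵐ s ∂(Measure.sum fun i => ENNReal.ofReal (c i) • Measure.dirac (x i)), 0 ≤ s := by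
  refine Measure.ae_sum_iff' measurableSet_Ici |>.2 fun i => Measure.ae_smul_measure ?_ _
  rw [ae_dirac_iff measurableSet_Ici]
  exact hx i

/-! ### The Tauberian theorem for lightcone blocks -/

section BlockTauberian

variable {ι : Type*} {v W : ι → ℝ} {Δ A : ℝ}

/-- The sum obtained from `∑ i, W i * κ(v i, 1 - X)` by replacing the blocks with the
Bessel kernel. -/
noncomputable def besselSum (v W : ι → ℝ) (X : ℝ) : ENNReal :=
  ∑' i, ENNReal.ofReal (W i * blockWeight (v i)) * besselKernel (v i ^ 2) X

theorem besselSum_anti {X Y : ℝ} (h : X ≤ Y) : besselSum v W Y ≤ besselSum v W X :=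
  ENNReal.tsum_le_tsum fun _ => mul_le_mul_right (besselKernel_anti h) _

theorem ofReal_tsum_mul_lightconeBlock (hv : ∀ i, 1 ≤ v i) (hW : ∀ i, 0 ≤ W i)
    (hsum : ∀ y : ℝ, 0 < y → y < 1 → Summable fun i => W i * lightconeBlock (v i) y)
    {X : ℝ} (hX : 0 < X) (hX1 : X < 1) :
    ENNReal.ofReal (∑' i, W i * lightconeBlock (v i) (1 - X)) =
      ∑' i, ENNReal.ofReal (W i) * ENNReal.ofReal (lightconeBlock (v i) (1 - X)) := by
  rw [ENNReal.ofReal_tsum_of_nonneg _ (hsum _ (by linarith) (by linarith))]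
  · exact tsum_congr fun i => ENNReal.ofReal_mul (hW i)
  · exact fun i => mul_nonneg (hW i)
      (lightconeBlock_pos (by linarith [hv i]) (by linarith) (by linarith)).le

theorem besselSum_le (hv : ∀ i, 1 ≤ v i) (hW : ∀ i, 0 ≤ W i)
    (hsum : ∀ y : ℝ, 0 < y → y < 1 → Summable fun i => W i * lightconeBlock (v i) y)
    {X : ℝ} (hX : 0 < X) (hX1 : X ≤ 1 / 2) :
    besselSum v W ((1 + Real.sqrt X) ^ 2 * X) ≤
      ENNReal.ofReal (∑' i, W i * lightconeBlock (v i) (1 - X)) := by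
  rw [ofReal_tsum_mul_lightconeBlock hv hW hsum hX (by linarith)]
  refine ENNReal.tsum_le_tsum fun i => ?_
  rw [ENNReal.ofReal_mul (hW i), mul_assoc]
  gcongr
  exact besselKernel_le_lightconeBlock (by linarith [hv i]) hX hX1

theorem besselSum_lt_top (hv : ∀ i, 1 ≤ v i) (hW : ∀ i, 0 ≤ W i)
    (hsum : ∀ y : ℝ, 0 < y → y < 1 → Summable fun i => W i * lightconeBlock (v i) y)
    {X : ℝ} (hX : 0 < X) : besselSum v W X < ⊤ := by
  have h0 : 0 < min (X / 4) (1 / 2) := by positivity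
  have h2 : min (X / 4) (1 / 2) ≤ 1 / 2 := min_le_right _ _
  refine (besselSum_anti ?_).trans_lt
    ((besselSum_le hv hW hsum h0 h2).trans_lt ENNReal.ofReal_lt_top)
  have h3 : Real.sqrt (min (X / 4) (1 / 2)) ≤ 1 := Real.sqrt_le_one.2 (by linarith)
  calc (1 + √(min (X / 4) (1 / 2))) ^ 2 * min (X / 4) (1 / 2) ≤ (1 + 1) ^ 2 * (X / 4) := by
        gcongr
        exact min_le_left _ _
    _ = X := by ring

/-- The weights sum against any decaying exponential in `v`: such an exponential is dominated
by the kernel at a small enough argument. -/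
theorem tsum_mul_rpow_lt_top (hv : ∀ i, 1 ≤ v i) (hW : ∀ i, 0 ≤ W i)
    (hsum : ∀ y : ℝ, 0 < y → y < 1 → Summable fun i => W i * lightconeBlock (v i) y)
    {η : ℝ} (hη : 0 < η) :
    ∑' i, ENNReal.ofReal (W i * blockWeight (v i) * (1 + η) ^ (1 - v i)) < ⊤ := by
  -- at `q = v / r` the kernel at `X = r ^ 2` is at least `exp (-3 r v) / 2`
  set r := Real.log (1 + η) / 3 with hr
  have hr0 : 0 < r := div_pos (Real.log_pos (by linarith)) (by norm_num)
  have hle : ∀ i, ENNReal.ofReal (W i * blockWeight (v i) * (1 + η) ^ (1 - v i)) ≤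
      ENNReal.ofReal (2 * (1 + η)) *
        (ENNReal.ofReal (W i * blockWeight (v i)) * besselKernel (v i ^ 2) (r ^ 2)) := by
    intro i
    have hvi : 0 < v i := by linarith [hv i]
    have hw : 0 ≤ W i * blockWeight (v i) := mul_nonneg (hW i) (blockWeight_pos hvi).le
    have h := le_besselKernel (sq_nonneg (v i)) (sq_nonneg r) (div_pos hvi hr0)
    have e : -(2 * r ^ 2 * (v i / r)) - v i ^ 2 / (v i / r) = -v i * Real.log (1 + η) := by
      have : Real.log (1 + η) = 3 * r := by rw [hr]; ring
      rw [this]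
      field_simp
      ring
    have e2 : Real.exp (-v i * Real.log (1 + η)) = (1 + η) ^ (-v i) := by
      rw [Real.rpow_def_of_pos (by positivity), mul_comm]
    rw [e, e2] at h
    calc _ = ENNReal.ofReal (2 * (1 + η)) * (ENNReal.ofReal (W i * blockWeight (v i)) *
            ENNReal.ofReal ((1 + η) ^ (-v i) / 2)) := by
          rw [← ENNReal.ofReal_mul hw, ← ENNReal.ofReal_mul (by positivity)]
          congr 1
          rw [sub_eq_add_neg, Real.rpow_add (by positivity), Real.rpow_one]
          ring
      _ ≤ _ := by gcongr
  refine (ENNReal.tsum_le_tsum hle).trans_lt ?_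
  rw [ENNReal.tsum_mul_left]
  exact ENNReal.mul_lt_top ENNReal.ofReal_lt_top (besselSum_lt_top hv hW hsum (by positivity))

theorem le_besselSum_add (hv : ∀ i, 1 ≤ v i) (hW : ∀ i, 0 ≤ W i)
    (hsum : ∀ y : ℝ, 0 < y → y < 1 → Summable fun i => W i * lightconeBlock (v i) y)
    {X η : ℝ} (hη : 0 < η) (hη1 : η < 1) (hX : 0 < X) (hX1 : X < 1) :
    ENNReal.ofReal (∑' i, W i * lightconeBlock (v i) (1 - X)) ≤
      besselSum v W ((1 - η) ^ 2 * X) +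
      (∑' i, ENNReal.ofReal (W i * blockWeight (v i) * (1 + η) ^ (1 - v i))) *
        ENNReal.ofReal (lightconeBlock 1 (1 - X) / blockWeight 1) := by
  rw [ofReal_tsum_mul_lightconeBlock hv hW hsum hX hX1, besselSum, ← ENNReal.tsum_mul_right,
    ← ENNReal.tsum_add]
  refine ENNReal.tsum_le_tsum fun i => ?_
  rw [mul_assoc (W i), ENNReal.ofReal_mul (hW i), ENNReal.ofReal_mul (hW i), mul_assoc, mul_assoc,
    ← mul_add]
  gcongr
  exact lightconeBlock_le_besselKernel hη hη1 (hv i) hX hX1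

/-- A logarithm is negligible against every negative power. -/
theorem tendsto_rpow_mul_lightconeBlock_bound (hΔ : 0 < Δ) :
    Tendsto (fun X : ℝ => X ^ Δ * (-Real.log X / (1 - X))) (𝓝[>] 0) (𝓝 0) := by
  have h1 := tendsto_log_mul_rpow_nhdsGT_zero hΔ
  have h2 : Tendsto (fun X : ℝ => 1 - X) (𝓝[>] 0) (𝓝 (1 - 0)) :=
    (tendsto_const_nhds.sub tendsto_id).mono_left nhdsWithin_le_nhds
  rw [sub_zero] at h2
  have := (h1.neg).div h2 one_ne_zero
  rw [neg_zero, zero_div] at this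
  refine this.congr fun X => ?_
  simp only [Pi.div_apply]
  ring

theorem tendsto_mul_nhdsGT_zero {c : ℝ} (hc : 0 < c) :
    Tendsto (fun X : ℝ => c * X) (𝓝[>] 0) (𝓝[>] 0) := by
  refine tendsto_nhdsWithin_iff.2 ⟨?_, ?_⟩
  · have : Tendsto (fun X : ℝ => c * X) (𝓝 0) (𝓝 (c * 0)) := tendsto_id.const_mul _
    rw [mul_zero] at this
    exact this.mono_left nhdsWithin_le_nhds
  · filter_upwards [self_mem_nhdsWithin] with X hX using mul_pos hc hX

theorem tendsto_rpow_mul_comp_mul {H : ℝ → ℝ} {c : ℝ} (hc : 0 < c)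
    (hlim : Tendsto (fun X : ℝ => X ^ Δ * H X) (𝓝[>] 0) (𝓝 A)) :
    Tendsto (fun X : ℝ => X ^ Δ * H (c * X)) (𝓝[>] 0) (𝓝 (c ^ (-Δ) * A)) := by
  refine ((hlim.comp (tendsto_mul_nhdsGT_zero hc)).const_mul (c ^ (-Δ))).congr' ?_
  filter_upwards [self_mem_nhdsWithin] with X (hX : 0 < X)
  simp only [Function.comp_apply]
  rw [Real.mul_rpow hc.le hX.le, Real.rpow_neg hc.le]
  field_simp

theorem tendsto_besselSum (hv : ∀ i, 1 ≤ v i) (hW : ∀ i, 0 ≤ W i) (hΔ : 0 < Δ)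
    (hsum : ∀ y : ℝ, 0 < y → y < 1 → Summable fun i => W i * lightconeBlock (v i) y)
    (hlim : Tendsto (fun X : ℝ => X ^ Δ * ∑' i, W i * lightconeBlock (v i) (1 - X)) (𝓝[>] 0)
      (𝓝 A)) :
    Tendsto (fun X : ℝ => X ^ Δ * (besselSum v W X).toReal) (𝓝[>] 0) (𝓝 A) := by
  have hsmall : ∀ b : ℝ, 0 < b → ∀ᶠ X : ℝ in 𝓝[>] 0, X < b := fun b hb =>
    (eventually_lt_nhds hb).filter_mono nhdsWithin_le_nhds
  have hpos : ∀ᶠ X : ℝ in 𝓝[>] 0, 0 < X := self_mem_nhdsWithin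
  set H : ℝ → ℝ := fun X => ∑' i, W i * lightconeBlock (v i) (1 - X) with hH
  have hH0 : ∀ X : ℝ, 0 < X → X < 1 → 0 ≤ H X := fun X hX hX1 => tsum_nonneg fun i =>
    mul_nonneg (hW i) (lightconeBlock_pos (by linarith [hv i]) (by linarith) (by linarith)).le
  refine tendsto_of_forall_squeeze (fun ε hε => ?_) (fun ε hε => ?_)
  · have hc : Tendsto (fun η : ℝ => (((1 - η) ^ 2)⁻¹) ^ (-Δ) * A) (𝓝[>] 0) (𝓝 A) := by
      have h1 : Tendsto (fun η : ℝ => ((1 - η) ^ 2)⁻¹) (𝓝 0) (𝓝 1) := by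
        have : ContinuousAt (fun η : ℝ => ((1 - η) ^ 2)⁻¹) 0 :=
          ContinuousAt.inv₀ (by fun_prop) (by norm_num)
        simpa using this.tendsto
      have h2 := (h1.rpow_const (p := -Δ) (Or.inl one_ne_zero)).mul_const A
      rw [Real.one_rpow, one_mul] at h2
      exact h2.mono_left nhdsWithin_le_nhds
    -- lower bound: the part of the blocks not controlled by the kernel is logarithmic in `X`
    obtain ⟨η, ⟨hη1, hη2⟩, hη0⟩ :=
      (((hc.eventually_const_lt (u := A - ε) (by linarith)).and (hsmall 1 one_pos)).and hpos).exists
    set c := ((1 - η) ^ 2)⁻¹ with hcdef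
    have h1η : 0 < 1 - η := by linarith
    have hc0 : 0 < c := by positivity
    set S := ∑' i, ENNReal.ofReal (W i * blockWeight (v i) * (1 + η) ^ (1 - v i)) with hS
    have hSt : S < ⊤ := tsum_mul_rpow_lt_top hv hW hsum hη0
    have hw1 := blockWeight_pos one_pos
    have hl1 := tendsto_rpow_mul_comp_mul hc0 hlim
    have hl2 := (tendsto_rpow_mul_comp_mul hc0
      (tendsto_rpow_mul_lightconeBlock_bound hΔ)).const_mul (S.toReal / blockWeight 1)
    rw [mul_zero, mul_zero] at hl2
    refine ⟨_, _, hl1.sub hl2, by rwa [sub_zero], ?_⟩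
    filter_upwards [hpos, (tendsto_mul_nhdsGT_zero hc0).eventually (hsmall 1 one_pos)]
      with X hX hcX1
    have hcX : 0 < c * X := by positivity
    have h := le_besselSum_add hv hW hsum hη0 hη2 hcX hcX1
    have e : (1 - η) ^ 2 * (c * X) = X := by rw [hcdef]; field_simp
    rw [e, ← hS] at h
    have hfin : besselSum v W X ≠ ⊤ := (besselSum_lt_top hv hW hsum hX).ne
    have hκ := lightconeBlock_le_log zero_le_one le_rfl (by linarith : 0 < 1 - c * X)
      (by linarith)
    rw [sub_sub_cancel] at hκ
    have hκ0 := lightconeBlock_pos zero_le_one (by linarith : 0 < 1 - c * X) (by linarith)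
    rw [ENNReal.ofReal_le_iff_le_toReal (by finiteness),
      ENNReal.toReal_add hfin (by finiteness), ENNReal.toReal_mul,
      ENNReal.toReal_ofReal (by positivity)] at h
    have h2 : S.toReal * (lightconeBlock 1 (1 - c * X) / blockWeight 1) ≤
        S.toReal / blockWeight 1 * (-Real.log (c * X) / (1 - c * X)) := by
      rw [mul_div_assoc', div_mul_eq_mul_div]
      gcongr
    have h3 : H (c * X) - S.toReal / blockWeight 1 * (-Real.log (c * X) / (1 - c * X)) ≤
        (besselSum v W X).toReal := by
      simp only [hH]; linarith
    calc _ = X ^ Δ * (H (c * X) -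
            S.toReal / blockWeight 1 * (-Real.log (c * X) / (1 - c * X))) := by
          simp only [hH]; ring
      _ ≤ _ := mul_le_mul_of_nonneg_left h3 (by positivity)
  · have hc : Tendsto (fun c : ℝ => (c⁻¹) ^ (-Δ) * A) (𝓝[>] 1) (𝓝 A) := by
      have h1 : Tendsto (fun c : ℝ => c⁻¹) (𝓝 1) (𝓝 1) := by
        simpa using (continuousAt_inv₀ (one_ne_zero (α := ℝ))).tendsto
      have h2 := (h1.rpow_const (p := -Δ) (Or.inl one_ne_zero)).mul_const A
      rw [Real.one_rpow, one_mul] at h2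
      exact h2.mono_left nhdsWithin_le_nhds
    -- upper bound: the argument `(1 + √X) ^ 2 X` of the kernel is at most `c X` for small `X`
    obtain ⟨c, hc1, hc2⟩ := ((hc.eventually_lt_const (u := A + ε) (by linarith)).and
      (self_mem_nhdsWithin : ∀ᶠ c : ℝ in 𝓝[>] 1, 1 < c)).exists
    have hc0 : 0 < c⁻¹ := by positivity
    refine ⟨_, _, tendsto_rpow_mul_comp_mul hc0 hlim, hc1, ?_⟩
    have hsq : ∀ᶠ X : ℝ in 𝓝[>] 0, (1 + Real.sqrt X) ^ 2 < c := by
      have : Tendsto (fun X : ℝ => (1 + Real.sqrt X) ^ 2) (𝓝 0) (𝓝 ((1 + Real.sqrt 0) ^ 2)) :=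
        Continuous.tendsto (by fun_prop) 0
      rw [Real.sqrt_zero] at this
      exact (this.mono_left nhdsWithin_le_nhds).eventually_lt_const (by linarith)
    filter_upwards [hpos, (tendsto_mul_nhdsGT_zero hc0).eventually
      ((hsmall (1 / 2) (by norm_num)).and hsq)] with X hX ⟨h1, h2⟩
    have hcX : 0 < c⁻¹ * X := by positivity
    refine mul_le_mul_of_nonneg_left ?_ (by positivity)
    refine ENNReal.toReal_le_of_le_ofReal (hH0 _ hcX (by linarith)) ?_
    refine le_trans (besselSum_anti ?_) (besselSum_le hv hW hsum hcX h1.le)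
    calc (1 + √(c⁻¹ * X)) ^ 2 * (c⁻¹ * X) ≤ c * (c⁻¹ * X) := by gcongr
      _ = X := by field_simp

/-- The Laplace transform of the weights in the variable `v ^ 2`, at `1 / q`. -/
noncomputable def gaussianSum (v W : ι → ℝ) (q : ℝ) : ℝ :=
  ∑' i, W i * blockWeight (v i) * Real.exp (-(v i ^ 2 / q))

theorem summable_gaussianSum (hv : ∀ i, 1 ≤ v i) (hW : ∀ i, 0 ≤ W i)
    (hsum : ∀ y : ℝ, 0 < y → y < 1 → Summable fun i => W i * lightconeBlock (v i) y)
    {q : ℝ} (hq : 0 < q) :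
    Summable fun i => W i * blockWeight (v i) * Real.exp (-(v i ^ 2 / q)) := by
  have hw : ∀ i, 0 ≤ W i * blockWeight (v i) := fun i =>
    mul_nonneg (hW i) (blockWeight_pos (by linarith [hv i])).le
  have hle : ∀ i, ENNReal.ofReal (W i * blockWeight (v i) * Real.exp (-(v i ^ 2 / q))) ≤
      ENNReal.ofReal (2 * Real.exp (2 * q)) *
        (ENNReal.ofReal (W i * blockWeight (v i)) * besselKernel (v i ^ 2) 1) := by
    intro i
    have h := le_besselKernel (sq_nonneg (v i)) zero_le_one hq
    calc _ = ENNReal.ofReal (2 * Real.exp (2 * q)) * (ENNReal.ofReal (W i * blockWeight (v i)) *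
            ENNReal.ofReal (Real.exp (-(2 * 1 * q) - v i ^ 2 / q) / 2)) := by
          rw [← ENNReal.ofReal_mul (hw i), ← ENNReal.ofReal_mul (by positivity)]
          congr 1
          have : Real.exp (-(v i ^ 2 / q)) =
              Real.exp (2 * q) * Real.exp (-(2 * 1 * q) - v i ^ 2 / q) := by
            rw [← Real.exp_add]; congr 1; ring
          rw [this]
          ring
      _ ≤ _ := by gcongr
  have hfin : ∑' i, ENNReal.ofReal (W i * blockWeight (v i) * Real.exp (-(v i ^ 2 / q))) ≠ ⊤ := by
    refine ((ENNReal.tsum_le_tsum hle).trans_lt ?_).ne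
    rw [ENNReal.tsum_mul_left]
    exact ENNReal.mul_lt_top ENNReal.ofReal_lt_top (besselSum_lt_top hv hW hsum one_pos)
  refine (ENNReal.summable_toReal hfin).congr fun i => ?_
  exact ENNReal.toReal_ofReal (mul_nonneg (hw i) (Real.exp_pos _).le)

theorem gaussianSum_mono (hv : ∀ i, 1 ≤ v i) (hW : ∀ i, 0 ≤ W i)
    (hsum : ∀ y : ℝ, 0 < y → y < 1 → Summable fun i => W i * lightconeBlock (v i) y)
    {q q' : ℝ} (hq : 0 < q) (h : q ≤ q') : gaussianSum v W q ≤ gaussianSum v W q' := by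
  refine (summable_gaussianSum hv hW hsum hq).tsum_le_tsum (fun i => ?_)
    (summable_gaussianSum hv hW hsum (hq.trans_le h))
  have hw : 0 ≤ W i * blockWeight (v i) :=
    mul_nonneg (hW i) (blockWeight_pos (by linarith [hv i])).le
  gcongr

theorem gaussianSum_nonneg (hv : ∀ i, 1 ≤ v i) (hW : ∀ i, 0 ≤ W i) (q : ℝ) :
    0 ≤ gaussianSum v W q :=
  tsum_nonneg fun i => mul_nonneg (mul_nonneg (hW i) (blockWeight_pos (by linarith [hv i])).le)
    (Real.exp_pos _).le

theorem measurable_gaussianSum [Countable ι] : Measurable (gaussianSum v W) := by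
  unfold gaussianSum
  exact Measurable.tsum fun i => by fun_prop

theorem lintegral_exp_mul_gaussianSum [Countable ι] (hv : ∀ i, 1 ≤ v i) (hW : ∀ i, 0 ≤ W i)
    (hsum : ∀ y : ℝ, 0 < y → y < 1 → Summable fun i => W i * lightconeBlock (v i) y) (X : ℝ) :
    ∫⁻ q in Ioi (0 : ℝ),
      ENNReal.ofReal (gaussianSum v W q / q) * ENNReal.ofReal (Real.exp (-(X * q)))
      = besselSum v W X := by
  have hw : ∀ i, 0 ≤ W i * blockWeight (v i) := fun i =>
    mul_nonneg (hW i) (blockWeight_pos (by linarith [hv i])).le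
  have : ∀ q ∈ Ioi (0 : ℝ), ENNReal.ofReal (gaussianSum v W q / q) *
      ENNReal.ofReal (Real.exp (-(X * q))) = ∑' i, ENNReal.ofReal (W i * blockWeight (v i)) *
        ENNReal.ofReal (Real.exp (-(X * q) - v i ^ 2 / q) / q) := by
    intro q (hq : 0 < q)
    have h0 := gaussianSum_nonneg hv hW q
    rw [← ENNReal.ofReal_mul (by positivity), div_mul_eq_mul_div, gaussianSum, ← tsum_mul_right,
      ← tsum_div_const, ENNReal.ofReal_tsum_of_nonneg]
    · refine tsum_congr fun i => ?_
      rw [← ENNReal.ofReal_mul (hw i)]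
      congr 1
      rw [mul_assoc, ← Real.exp_add, mul_div_assoc]
      congr 3
      ring
    · intro i
      have := hw i
      positivity
    · exact ((summable_gaussianSum hv hW hsum hq).mul_right _).div_const _
  rw [setLIntegral_congr_fun measurableSet_Ioi this, lintegral_tsum (fun i => by fun_prop)]
  refine tsum_congr fun i => ?_
  rw [lintegral_const_mul _ (by fun_prop), besselKernel]

theorem lintegral_inv_Ioc {q q' : ℝ} (hq : 0 < q) (h : q ≤ q') :
    ∫⁻ s in Ioc q q', ENNReal.ofReal (1 / s) = ENNReal.ofReal (Real.log (q' / q)) := by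
  have h0 : (0 : ℝ) ∉ uIcc q q' := by
    rw [uIcc_of_le h]
    exact fun h' => (hq.trans_le h'.1).false
  rw [← ofReal_integral_eq_lintegral_ofReal]
  · rw [← intervalIntegral.integral_of_le h, integral_one_div h0]
  · have := intervalIntegral.intervalIntegrable_one_div (μ := volume) (f := fun s : ℝ => s)
      (a := q) (b := q') (fun s hs => fun h' => h0 (h' ▸ hs)) continuousOn_id
    exact (intervalIntegrable_iff_integrableOn_Ioc_of_le h).1 this
  · filter_upwards [ae_restrict_mem measurableSet_Ioc] with s hs
    have : 0 < s := hq.trans hs.1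
    simp only [Pi.zero_apply]
    positivity

/-- The first Tauberian step: `∫ exp(-X q) N(q) dq / q ∼ A X ^ (-Δ)` with `N` increasing
implies `N(q) ∼ A q ^ Δ / Γ(Δ)`. -/
theorem tendsto_gaussianSum [Countable ι] (hv : ∀ i, 1 ≤ v i) (hW : ∀ i, 0 ≤ W i) (hΔ : 0 < Δ)
    (hsum : ∀ y : ℝ, 0 < y → y < 1 → Summable fun i => W i * lightconeBlock (v i) y)
    (hlim : Tendsto (fun X : ℝ => X ^ Δ * ∑' i, W i * lightconeBlock (v i) (1 - X)) (𝓝[>] 0)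
      (𝓝 A)) :
    Tendsto (fun q : ℝ => q ^ (-Δ) * gaussianSum v W q) atTop (𝓝 (A / Real.Gamma Δ)) := by
  set D : ℝ → ENNReal := fun q => ENNReal.ofReal (gaussianSum v W q / q) with hD
  have hDm : Measurable D := (measurable_gaussianSum.div measurable_id).ennreal_ofReal
  -- Karamata's theorem is applied to `μ = N(q) dq / q`, whose Laplace transform is `besselSum`
  set μ : Measure ℝ := (volume.restrict (Ioi 0)).withDensity D with hμ
  have hlap : ∀ X : ℝ, ∫⁻ q, ENNReal.ofReal (Real.exp (-(X * q))) ∂μ = besselSum v W X := by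
    intro X
    rw [hμ, lintegral_withDensity_eq_lintegral_mul _ hDm (by fun_prop)]
    exact lintegral_exp_mul_gaussianSum hv hW hsum X
  have hint : ∀ X : ℝ, 0 < X → Integrable (fun q => Real.exp (-(X * q))) μ := by
    intro X hX
    refine ⟨by fun_prop, ?_⟩
    rw [hasFiniteIntegral_iff_ofReal (ae_of_all _ fun q => (Real.exp_pos _).le), hlap]
    exact besselSum_lt_top hv hW hsum hX
  have hpos : ∀ᵐ q ∂μ, 0 ≤ q := by
    have : ∀ᵐ q ∂(volume.restrict (Ioi (0 : ℝ))), 0 ≤ q :=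
      (ae_restrict_mem measurableSet_Ioi).mono fun q (hq : 0 < q) => hq.le
    exact (withDensity_absolutelyContinuous _ _).ae_le this
  have hkar := tendsto_measureReal_of_tendsto_laplace (s := fun q : ℝ => q) measurable_id hpos hΔ
    hint (C := A) <| by
      refine (tendsto_besselSum hv hW hΔ hsum hlim).congr' ?_
      filter_upwards [self_mem_nhdsWithin] with X hX
      rw [integral_eq_lintegral_of_nonneg_ae (ae_of_all _ fun q => (Real.exp_pos _).le)
        (by fun_prop), hlap]
  have hfin : ∀ Q : ℝ, μ {q | q ≤ Q} ≠ ⊤ := by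
    intro Q
    have h1 : μ {q | q ≤ Q} ≤
        ∫⁻ q, ENNReal.ofReal (Real.exp Q) * ENNReal.ofReal (Real.exp (-(1 * q))) ∂μ := by
      have hset : {q : ℝ | q ≤ Q} = Iic Q := rfl
      rw [hset, ← lintegral_indicator_one measurableSet_Iic]
      refine lintegral_mono fun q => ?_
      by_cases h : q ≤ Q
      · rw [← ENNReal.ofReal_mul (Real.exp_pos _).le, ← Real.exp_add]
        simp [h]
      · simp [h]
    rw [lintegral_const_mul _ (by fun_prop), hlap] at h1
    exact (h1.trans_lt (ENNReal.mul_lt_top ENNReal.ofReal_lt_top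
      (besselSum_lt_top hv hW hsum one_pos))).ne
  have hmass : ∀ q q' : ℝ, 0 < q → μ (Ioc q q') =
      ∫⁻ s in Ioc q q', ENNReal.ofReal (gaussianSum v W s / s) := by
    intro q q' hq
    rw [hμ, withDensity_apply _ measurableSet_Ioc, Measure.restrict_restrict measurableSet_Ioc,
      inter_eq_left.2 (Ioc_subset_Ioi_self.trans (Ioi_subset_Ioi hq.le))]
  have hdens := tendsto_density_of_tendsto_primitive (N := gaussianSum v W) (α := Δ)
    (c := A / Real.Gamma (Δ + 1)) (I := fun Q => μ.real {q | q ≤ Q}) ?_ hkar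
  · convert hdens using 2
    have := (Real.Gamma_pos_of_pos hΔ).ne'
    rw [Real.Gamma_add_one hΔ.ne']
    field_simp
  · intro q q' hq hqq'
    have hlog : 0 ≤ Real.log (q' / q) := Real.log_nonneg ((one_le_div hq).2 hqq'.le)
    have hdiff : μ.real {s | s ≤ q'} - μ.real {s | s ≤ q} = μ.real (Ioc q q') := by
      have h1 : Ioc q q' = {s | s ≤ q'} \ {s | s ≤ q} := by
        ext s; simp [and_comm]
      have h2 : {s | s ≤ q} ⊆ {s | s ≤ q'} := fun s (hs : s ≤ q) => hs.trans hqq'.le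
      rw [h1, measureReal_sdiff h2 measurableSet_Iic (hfin q')]
    have hfinI : μ (Ioc q q') ≠ ⊤ := ((measure_mono fun s hs => hs.2).trans_lt (hfin q').lt_top).ne
    have hconst : ∀ c : ℝ, 0 ≤ c → ∫⁻ s in Ioc q q', ENNReal.ofReal (c * (1 / s)) =
        ENNReal.ofReal (c * Real.log (q' / q)) := by
      intro c hc
      simp_rw [ENNReal.ofReal_mul hc]
      rw [lintegral_const_mul _ (by fun_prop), lintegral_inv_Ioc hq hqq'.le]
    have hN := gaussianSum_nonneg hv hW
    simp only [hdiff]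
    constructor
    · rw [Measure.real, ← ENNReal.ofReal_le_iff_le_toReal hfinI, hmass q q' hq,
        ← hconst _ (hN q)]
      refine setLIntegral_mono' measurableSet_Ioc fun s hs => ENNReal.ofReal_le_ofReal ?_
      have hs0 : 0 < s := hq.trans hs.1
      rw [mul_one_div]
      exact div_le_div_of_nonneg_right (gaussianSum_mono hv hW hsum hq hs.1.le) hs0.le
    · refine ENNReal.toReal_le_of_le_ofReal (mul_nonneg (hN q') hlog) ?_
      rw [hmass q q' hq, ← hconst _ (hN q')]
      refine setLIntegral_mono' measurableSet_Ioc fun s hs => ENNReal.ofReal_le_ofReal ?_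
      have hs0 : 0 < s := hq.trans hs.1
      rw [mul_one_div]
      exact div_le_div_of_nonneg_right (gaussianSum_mono hv hW hsum hs0 hs.2) hs0.le

/-- The second Tauberian step, in the variable `v ^ 2`. -/
theorem tendsto_tsum_weight_of_one_le [Countable ι] (hv : ∀ i, 1 ≤ v i) (hW : ∀ i, 0 ≤ W i)
    (hΔ : 0 < Δ)
    (hsum : ∀ y : ℝ, 0 < y → y < 1 → Summable fun i => W i * lightconeBlock (v i) y)
    (hlim : Tendsto (fun X : ℝ => X ^ Δ * ∑' i, W i * lightconeBlock (v i) (1 - X)) (𝓝[>] 0)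
      (𝓝 A)) :
    Tendsto (fun Λ : ℝ => Λ ^ (-2 * Δ) * ∑' i, if v i ≤ Λ then W i * blockWeight (v i) else 0)
      atTop (𝓝 (A / (Real.Gamma Δ * Real.Gamma (Δ + 1)))) := by
  have hw : ∀ i, 0 ≤ W i * blockWeight (v i) := fun i =>
    mul_nonneg (hW i) (blockWeight_pos (by linarith [hv i])).le
  -- the Laplace transform of `μ` at `p` is `gaussianSum` at `1 / p`
  set μ : Measure ℝ := Measure.sum fun i =>
    ENNReal.ofReal (W i * blockWeight (v i)) • Measure.dirac (v i ^ 2) with hμ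
  have hexp : ∀ p : ℝ, 0 < p → Integrable (fun s => Real.exp (-(p * s))) μ ∧
      ∫ s, Real.exp (-(p * s)) ∂μ = gaussianSum v W p⁻¹ := by
    intro p hp
    have e : ∀ i, Real.exp (-(p * v i ^ 2)) = Real.exp (-(v i ^ 2 / p⁻¹)) := fun i => by
      rw [div_inv_eq_mul, mul_comm]
    have hm : StronglyMeasurable fun s => Real.exp (-(p * s)) := by fun_prop
    have h := integrable_sum_smul_dirac (x := fun i => v i ^ 2) hw hm (by
      simp only [Real.norm_eq_abs, Real.abs_exp, e]
      exact summable_gaussianSum hv hW hsum (inv_pos.2 hp))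
    refine ⟨h, ?_⟩
    rw [← (hasSum_integral_sum_smul_dirac hw hm h).tsum_eq, gaussianSum]
    simp only [smul_eq_mul, e]
  have hpos : ∀ᵐ s ∂μ, 0 ≤ s := ae_nonneg_sum_smul_dirac fun i => sq_nonneg _
  have hkar := tendsto_measureReal_of_tendsto_laplace (s := fun q : ℝ => q) measurable_id hpos hΔ
    (fun p hp => (hexp p hp).1) (C := A / Real.Gamma Δ) <| by
      refine ((tendsto_gaussianSum hv hW hΔ hsum hlim).comp tendsto_inv_nhdsGT_zero).congr' ?_
      filter_upwards [self_mem_nhdsWithin] with p (hp : 0 < p)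
      rw [(hexp p hp).2]
      simp only [Function.comp_apply]
      rw [Real.rpow_neg (by positivity), Real.inv_rpow hp.le, inv_inv]
  have hsq : Tendsto (fun Λ : ℝ => Λ ^ 2) atTop atTop := tendsto_pow_atTop two_ne_zero
  rw [div_div] at hkar
  refine (hkar.comp hsq).congr' ?_
  filter_upwards [eventually_gt_atTop 0] with Λ hΛ
  simp only [Function.comp_apply]
  congr 1
  · rw [← Real.rpow_natCast, ← Real.rpow_mul hΛ.le]
    congr 1
    push_cast
    ring
  · have hset : {s : ℝ | s ≤ Λ ^ 2} = Iic (Λ ^ 2) := rfl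
    rw [hset, Measure.real, hμ, Measure.sum_apply _ measurableSet_Iic, ENNReal.tsum_toReal_eq]
    · refine tsum_congr fun i => ?_
      rw [Measure.smul_apply, Measure.dirac_apply' _ measurableSet_Iic, smul_eq_mul]
      have : v i ^ 2 ≤ Λ ^ 2 ↔ v i ≤ Λ :=
        pow_le_pow_iff_left₀ (by linarith [hv i]) hΛ.le two_ne_zero
      by_cases h : v i ≤ Λ
      · simp [this.2 h, h, ENNReal.toReal_ofReal (hw i)]
      · simp [mt this.1 h, h]
    · intro i
      rw [Measure.smul_apply, smul_eq_mul]
      exact ENNReal.mul_ne_top ENNReal.ofReal_ne_top (measure_ne_top _ _)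

theorem summable_ite_le (hv : ∀ i, 0 ≤ v i) (hW : ∀ i, 0 ≤ W i)
    (hsum : ∀ y : ℝ, 0 < y → y < 1 → Summable fun i => W i * lightconeBlock (v i) y) (Λ : ℝ) :
    Summable fun i => if v i ≤ Λ then W i else 0 := by
  refine Summable.of_nonneg_of_le (fun i => ?_) (fun i => ?_)
    ((hsum (1 / 2) (by norm_num) (by norm_num)).mul_left (Real.sqrt (Λ + 1) / (1 / 8) ^ Λ))
  · split_ifs
    exacts [hW i, le_rfl]
  · have hκ := lightconeBlock_pos (hv i) (y := 1 / 2) (by norm_num) (by norm_num)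
    have hWi := hW i
    split_ifs with h
    · have hle := le_lightconeBlock (hv i) (y := 1 / 2) (by norm_num) (by norm_num)
      have hΛ : 0 ≤ Λ := (hv i).trans h
      have h1 : (1 / 8 : ℝ) ^ Λ / Real.sqrt (Λ + 1) ≤ lightconeBlock (v i) (1 / 2) := by
        refine le_trans ?_ hle
        have h2 : (1 / 8 : ℝ) ^ Λ ≤ (1 / 2 / 4 : ℝ) ^ v i := by
          rw [show (1 / 2 / 4 : ℝ) = 1 / 8 by norm_num]
          exact Real.rpow_le_rpow_of_exponent_ge (by norm_num) (by norm_num) h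
        have h3 : 0 < Real.sqrt (v i + 1) := Real.sqrt_pos.2 (by linarith [hv i])
        gcongr
      have h4 : 0 < Real.sqrt (Λ + 1) := Real.sqrt_pos.2 (by linarith)
      have h8 : (0 : ℝ) < (1 / 8) ^ Λ := by positivity
      calc W i = Real.sqrt (Λ + 1) / (1 / 8) ^ Λ * (W i * ((1 / 8) ^ Λ / Real.sqrt (Λ + 1))) := by
            field_simp
        _ ≤ _ := by gcongr
    · positivity

/-- Blocks with `v < 1` do not contribute to the leading singularity at `y = 1`. -/
theorem tendsto_tsum_one_le (hv : ∀ i, 0 ≤ v i) (hW : ∀ i, 0 ≤ W i) (hΔ : 0 < Δ)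
    (hsum : ∀ y : ℝ, 0 < y → y < 1 → Summable fun i => W i * lightconeBlock (v i) y)
    (hlim : Tendsto (fun X : ℝ => X ^ Δ * ∑' i, W i * lightconeBlock (v i) (1 - X)) (𝓝[>] 0)
      (𝓝 A)) :
    Tendsto (fun X : ℝ => X ^ Δ *
      ∑' i : {i | 1 ≤ v i}, W i * lightconeBlock (v i) (1 - X)) (𝓝[>] 0) (𝓝 A) := by
  set s : Set ι := {i | 1 ≤ v i} with hs
  have hWs : Summable fun i : (sᶜ : Set ι) => W i := by
    refine ((summable_ite_le hv hW hsum 1).subtype sᶜ).congr fun i => ?_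
    have h : ¬ 1 ≤ v i := i.2
    simp [(not_le.1 h).le]
  have hsmall : Tendsto (fun X : ℝ => X ^ Δ *
      ∑' i : (sᶜ : Set ι), W i * lightconeBlock (v i) (1 - X)) (𝓝[>] 0) (𝓝 0) := by
    have hb := (tendsto_rpow_mul_lightconeBlock_bound hΔ).const_mul
      (∑' i : (sᶜ : Set ι), W i)
    rw [mul_zero] at hb
    refine tendsto_of_tendsto_of_tendsto_of_le_of_le' tendsto_const_nhds hb ?_ ?_
    · filter_upwards [self_mem_nhdsWithin,
        (eventually_lt_nhds one_pos).filter_mono nhdsWithin_le_nhds] with X (hX : 0 < X) hX1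
      exact mul_nonneg (by positivity) (tsum_nonneg fun i => mul_nonneg (hW i)
        (lightconeBlock_pos (hv i) (by linarith) (by linarith)).le)
    · filter_upwards [self_mem_nhdsWithin,
        (eventually_lt_nhds one_pos).filter_mono nhdsWithin_le_nhds] with X (hX : 0 < X) hX1
      have h1 : ∑' i : (sᶜ : Set ι), W i * lightconeBlock (v i) (1 - X) ≤
          ∑' i : (sᶜ : Set ι), W i * (-Real.log X / (1 - X)) := by
        refine ((hsum _ (by linarith) (by linarith)).subtype sᶜ).tsum_le_tsum (fun i => ?_)
          (hWs.mul_right _)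
        have h : ¬ 1 ≤ v i := i.2
        have := lightconeBlock_le_log (hv i) (not_le.1 h).le (by linarith : 0 < 1 - X)
          (by linarith)
        rw [sub_sub_cancel] at this
        exact mul_le_mul_of_nonneg_left this (hW i)
      rw [tsum_mul_right] at h1
      calc _ ≤ X ^ Δ * ((∑' i : (sᶜ : Set ι), W i) * (-Real.log X / (1 - X))) :=
            mul_le_mul_of_nonneg_left h1 (by positivity)
        _ = _ := by ring
  have := hlim.sub hsmall
  rw [sub_zero] at this
  refine this.congr' ?_
  filter_upwards [self_mem_nhdsWithin,
    (eventually_lt_nhds one_pos).filter_mono nhdsWithin_le_nhds] with X (hX : 0 < X) hX1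
  rw [← (hsum (1 - X) (by linarith) (by linarith)).tsum_subtype_add_tsum_subtype_compl s]
  ring

/-- **Tauberian theorem for lightcone blocks**: a sum of blocks with nonnegative weights
asymptotic to `A (1 - y) ^ (-Δ)` as `y` increases to `1` has summatory function of its weights
asymptotic to `2 √π A Λ ^ (2 Δ) / (Γ(Δ) Γ(Δ + 1))`. -/
theorem tendsto_tsum_weight [Countable ι] (hv : ∀ i, 0 ≤ v i) (hW : ∀ i, 0 ≤ W i) (hΔ : 0 < Δ)
    (hsum : ∀ y : ℝ, 0 < y → y < 1 → Summable fun i => W i * lightconeBlock (v i) y)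
    (hlim : Tendsto (fun X : ℝ => X ^ Δ * ∑' i, W i * lightconeBlock (v i) (1 - X)) (𝓝[>] 0)
      (𝓝 A)) :
    Tendsto (fun Λ : ℝ => Λ ^ (-2 * Δ) * ∑' i, if v i ≤ Λ then W i else 0)
      atTop (𝓝 (2 * Real.sqrt Real.pi * A / (Real.Gamma Δ * Real.Gamma (Δ + 1)))) := by
  set s : Set ι := {i | 1 ≤ v i} with hs
  have hWs : ∀ i : s, 0 ≤ W i := fun i => hW i
  have hvs : ∀ i : s, 1 ≤ v i := fun i => i.2
  have hsums : ∀ y : ℝ, 0 < y → y < 1 → Summable fun i : s => W i * lightconeBlock (v i) y :=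
    fun y hy hy1 => (hsum y hy hy1).subtype s
  have hlims := tendsto_tsum_weight_of_one_le hvs hWs hΔ hsums
    (tendsto_tsum_one_le hv hW hΔ hsum hlim)
  set B := A / (Real.Gamma Δ * Real.Gamma (Δ + 1)) with hB
  set a₀ := 1 / (2 * Real.sqrt Real.pi) with ha₀
  have hpi : 0 < Real.sqrt Real.pi := Real.sqrt_pos.2 Real.pi_pos
  have ha₀pos : 0 < a₀ := by positivity
  have hBa : 2 * Real.sqrt Real.pi * A / (Real.Gamma Δ * Real.Gamma (Δ + 1)) = B / a₀ := by
    rw [hB, ha₀]; field_simp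
  rw [hBa]
  have hw0 : ∀ i : s, 0 ≤ W i * blockWeight (v i) := fun i =>
    mul_nonneg (hW i) (blockWeight_pos (by linarith [hvs i])).le
  have hg : ∀ Λ : ℝ, Summable fun i : s => if v i ≤ Λ then W i * blockWeight (v i) else 0 := by
    intro Λ
    refine Summable.of_nonneg_of_le (fun i => ?_) (fun i => ?_)
      ((summable_gaussianSum hvs hWs hsums one_pos).mul_left (Real.exp (Λ ^ 2)))
    · split_ifs
      exacts [hw0 i, le_rfl]
    · have := hw0 i
      split_ifs with h
      · have h2 : v i ^ 2 ≤ Λ ^ 2 := pow_le_pow_left₀ (hv i) h 2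
        calc W i * blockWeight (v i) ≤
              Real.exp (Λ ^ 2 - v i ^ 2 / 1) * (W i * blockWeight (v i)) :=
              le_mul_of_one_le_left this (Real.one_le_exp (by linarith))
          _ = _ := by rw [sub_eq_add_neg, Real.exp_add]; ring
      · positivity
  set U : ℝ → ℝ := fun Λ => ∑' i, if v i ≤ Λ then W i else 0 with hU
  set S : ℝ → ℝ := fun Λ => ∑' i : s, if v i ≤ Λ then W i * blockWeight (v i) else 0 with hS
  have hpow0 : Tendsto (fun Λ : ℝ => Λ ^ (-2 * Δ)) atTop (𝓝 0) := by
    simpa using tendsto_rpow_neg_atTop (by positivity : 0 < 2 * Δ)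
  -- beyond some `V`, `blockWeight` is within a factor `lam` of its limit `a₀`; the labels below
  -- `V` contribute a constant, which the factor `Λ ^ (-2 Δ)` kills
  have hup : ∀ lam : ℝ, 1 < lam → ∃ V : ℝ, ∀ Λ, U Λ ≤ U V + lam / a₀ * S Λ := by
    intro lam hlam
    have hev := (tendsto_blockWeight.eventually_const_lt
      (u := a₀ / lam) (div_lt_self ha₀pos hlam)).and (eventually_ge_atTop 1)
    obtain ⟨V, hV⟩ := eventually_atTop.1 hev
    refine ⟨V, fun Λ => ?_⟩
    have hgi := (summable_subtype_iff_indicator (f := fun i =>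
      if v i ≤ Λ then W i * blockWeight (v i) else 0)).1 (hg Λ)
    have hSi : S Λ = ∑' i, s.indicator
        (fun i => if v i ≤ Λ then W i * blockWeight (v i) else 0) i :=
      tsum_subtype s (fun i => if v i ≤ Λ then W i * blockWeight (v i) else 0)
    rw [hSi, ← tsum_mul_left, hU]
    simp only
    rw [← (summable_ite_le hv hW hsum V).tsum_add (hgi.mul_left _)]
    refine (summable_ite_le hv hW hsum Λ).tsum_le_tsum (fun i => ?_)
      ((summable_ite_le hv hW hsum V).add (hgi.mul_left _))
    have hnn : 0 ≤ s.indicator (fun i => if v i ≤ Λ then W i * blockWeight (v i) else 0) i := by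
      refine indicator_nonneg (fun j hj => ?_) i
      have := hw0 ⟨j, hj⟩
      split_ifs
      exacts [this, le_rfl]
    have hWi := hW i
    by_cases h1 : v i ≤ Λ
    · by_cases h2 : v i ≤ V
      · simp only [h1, h2, if_true]
        have : 0 ≤ lam / a₀ * s.indicator
            (fun i => if v i ≤ Λ then W i * blockWeight (v i) else 0) i := by positivity
        linarith
      · obtain ⟨h3, -⟩ := hV (v i) (not_le.1 h2).le
        have h4 : i ∈ s := (hV V le_rfl).2.trans (not_le.1 h2).le
        simp only [h1, h2, if_true, if_false, zero_add, indicator_of_mem h4]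
        have h5 : 1 ≤ lam / a₀ * blockWeight (v i) := by
          rw [div_mul_eq_mul_div, one_le_div ha₀pos]
          rw [div_lt_iff₀ (by linarith)] at h3
          linarith
        calc W i ≤ W i * (lam / a₀ * blockWeight (v i)) := le_mul_of_one_le_right hWi h5
          _ = _ := by ring
    · simp only [h1, if_false]
      have h6 : 0 ≤ if v i ≤ V then W i else 0 := by split_ifs <;> simp [hWi]
      positivity
  have hlow : ∀ lam : ℝ, 1 < lam → ∃ V : ℝ, ∀ Λ, S Λ ≤ S V + lam * a₀ * U Λ := by
    intro lam hlam
    have hev := tendsto_blockWeight.eventually_lt_const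
      (u := lam * a₀) (lt_mul_of_one_lt_left ha₀pos hlam)
    obtain ⟨V, hV⟩ := eventually_atTop.1 hev
    refine ⟨V, fun Λ => ?_⟩
    have hus : Summable fun i : s => if v i ≤ Λ then W i else 0 :=
      (summable_ite_le hv hW hsum Λ).subtype s
    have h1 : ∑' i : s, (if v i ≤ Λ then W i else 0) ≤ U Λ :=
      (summable_ite_le hv hW hsum Λ).tsum_subtype_le _ s
        (fun i => by split_ifs <;> simp [hW i])
    have h2 : S Λ ≤ S V + lam * a₀ * ∑' i : s, (if v i ≤ Λ then W i else 0) := by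
      rw [← tsum_mul_left, hS]
      simp only
      rw [← (hg V).tsum_add (hus.mul_left _)]
      refine (hg Λ).tsum_le_tsum (fun i => ?_) ((hg V).add (hus.mul_left _))
      have hwi := hw0 i
      have hWi := hW i
      by_cases h1 : v i ≤ Λ
      · by_cases h2 : v i ≤ V
        · simp only [h1, h2, if_true]
          have : 0 ≤ lam * a₀ * W i := by positivity
          linarith
        · have h3 := hV (v i) (not_le.1 h2).le
          simp only [h1, h2, if_true, if_false, zero_add]
          rw [mul_comm]
          exact mul_le_mul_of_nonneg_right h3.le hWi
      · simp only [h1, if_false, mul_zero, add_zero]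
        split_ifs <;> simp [hwi]
    refine h2.trans ?_
    gcongr
  have hone : ∀ᶠ lam : ℝ in 𝓝[>] 1, 1 < lam := self_mem_nhdsWithin
  refine tendsto_of_forall_squeeze (fun ε hε => ?_) (fun ε hε => ?_)
  · have hc : Tendsto (fun lam : ℝ => (B - 0) / (lam * a₀)) (𝓝[>] 1) (𝓝 (B / a₀)) := by
      have : ContinuousAt (fun lam : ℝ => (B - 0) / (lam * a₀)) 1 :=
        ContinuousAt.div (by fun_prop) (by fun_prop) (by simpa using ha₀pos.ne')
      have h := this.tendsto
      simp only [sub_zero, one_mul] at h ⊢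
      exact h.mono_left nhdsWithin_le_nhds
    obtain ⟨lam, hl1, hl2⟩ :=
      ((hc.eventually_const_lt (u := B / a₀ - ε) (by linarith)).and hone).exists
    obtain ⟨V, hV⟩ := hlow lam hl2
    have hz : Tendsto (fun Λ : ℝ => Λ ^ (-2 * Δ) * S V) atTop (𝓝 0) := by
      simpa using hpow0.mul_const (S V)
    refine ⟨_, _, (hlims.sub hz).div_const (lam * a₀), hl1, ?_⟩
    filter_upwards [eventually_gt_atTop 0] with Λ hΛ
    rw [div_le_iff₀ (by positivity), ← mul_sub, mul_assoc]
    refine mul_le_mul_of_nonneg_left ?_ (by positivity)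
    have := hV Λ
    simp only [hS, hU] at this ⊢
    linarith
  · have hc : Tendsto (fun lam : ℝ => 0 + lam / a₀ * B) (𝓝[>] 1) (𝓝 (B / a₀)) := by
      have : Continuous (fun lam : ℝ => 0 + lam / a₀ * B) := by fun_prop
      have h := this.tendsto 1
      rw [show 0 + 1 / a₀ * B = B / a₀ by ring] at h
      exact h.mono_left nhdsWithin_le_nhds
    obtain ⟨lam, hl1, hl2⟩ :=
      ((hc.eventually_lt_const (u := B / a₀ + ε) (by linarith)).and hone).exists
    obtain ⟨V, hV⟩ := hup lam hl2
    have hz : Tendsto (fun Λ : ℝ => Λ ^ (-2 * Δ) * U V) atTop (𝓝 0) := by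
      simpa using hpow0.mul_const (U V)
    refine ⟨_, _, hz.add (hlims.const_mul (lam / a₀)), hl1, ?_⟩
    filter_upwards [eventually_gt_atTop 0] with Λ hΛ
    calc Λ ^ (-2 * Δ) * U Λ ≤ Λ ^ (-2 * Δ) * (U V + lam / a₀ * S Λ) :=
          mul_le_mul_of_nonneg_left (hV Λ) (by positivity)
      _ = _ := by simp only [hS, hU]; ring

end BlockTauberian

/-! ### The lightcone limit of the correlator -/

namespace CorrelatorData

variable {D : CorrelatorData}

theorem term_ofReal {z zb : ℝ} (hz : 0 < z) (hzb : 0 < zb) (p : D.Label) :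
    D.term z zb p = ((D.c p.1 p.2 * z ^ D.h p * zb ^ D.hbar p : ℝ) : ℂ) := by
  rw [term]
  push_cast
  rw [Complex.ofReal_cpow hz.le, Complex.ofReal_cpow hzb.le]

theorem norm_term_ofReal (hD : D.IsCorrelator) {z zb : ℝ} (hz : 0 < z) (hzb : 0 < zb)
    (p : D.Label) : ‖D.term z zb p‖ = D.c p.1 p.2 * z ^ D.h p * zb ^ D.hbar p := by
  rw [term_ofReal hz hzb, Complex.norm_real, Real.norm_of_nonneg]
  have := hD.c_nonneg p.1 p.2 (Nat.lt_succ_iff.1 p.2.2)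
  positivity

theorem hbar_pos (hD : D.IsCorrelator) {p : D.Label} (hp : p.1 ≠ 0) : 0 < D.hbar p := by
  obtain ⟨τ, hτ, h⟩ := hD.twist_gap
  have h1 := h p.1 (Nat.pos_of_ne_zero hp)
  have h2 : ((p.2 : ℕ) : ℝ) ≤ D.l p.1 := by exact_mod_cast Nat.lt_succ_iff.1 p.2.2
  rw [hbar]
  linarith

theorem val_eq_zero (hD : D.IsCorrelator) {p : D.Label} (hp : p.1 = 0) : (p.2 : ℕ) = 0 := by
  have h1 : (p.2 : ℕ) < D.l p.1 + 1 := p.2.2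
  have h2 : D.l p.1 = 0 := by rw [hp, hD.l_zero]
  omega

theorem h_eq_zero (hD : D.IsCorrelator) {p : D.Label} (hp : p.1 = 0) : D.h p = 0 := by
  rw [h, val_eq_zero hD hp, hp, hD.E_zero, hD.l_zero]
  simp

theorem hbar_eq_zero (hD : D.IsCorrelator) {p : D.Label} (hp : p.1 = 0) : D.hbar p = 0 := by
  rw [hbar, val_eq_zero hD hp, hp, hD.E_zero, hD.l_zero]
  simp

theorem term_eq_one (hD : D.IsCorrelator) {p : D.Label} (hp : p.1 = 0) (z zb : ℂ) :
    D.term z zb p = 1 := by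
  rw [term, h_eq_zero hD hp, hbar_eq_zero hD hp, val_eq_zero hD hp, hp, hD.c_zero]
  simp

theorem eq_identity_label (hD : D.IsCorrelator) {p : D.Label} (hp : p.1 = 0) :
    p = ⟨0, 0⟩ := by
  obtain ⟨k, j⟩ := p
  obtain rfl : k = 0 := hp
  congr 1
  exact Fin.ext (val_eq_zero (p := ⟨0, j⟩) hD rfl)

/-- As `zb` decreases to `0` only the identity contribution survives, by the twist gap. -/
theorem tendsto_tsum_term (hD : D.IsCorrelator) {z : ℝ} (hz : 0 < z) (hz1 : z < 1) :
    Tendsto (fun X : ℝ => ∑' p, D.term z X p) (𝓝[>] 0) (𝓝 1) := by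
  classical
  have hsum : Summable fun p => ‖D.term (z : ℂ) ((1 / 2 : ℝ) : ℂ) p‖ := by
    refine hD.abs_conv _ _ ?_ ?_ ?_ ?_ <;> rw [Complex.norm_real, Real.norm_of_nonneg] <;>
      linarith
  have hlim := tendsto_tsum_of_dominated_convergence (𝓕 := 𝓝[>] (0 : ℝ))
    (f := fun X : ℝ => D.term z X) (g := fun p => if p = ⟨0, 0⟩ then (1 : ℂ) else 0) hsum ?_ ?_
  · rwa [tsum_ite_eq] at hlim
  · intro p
    by_cases hp : p.1 = 0
    · rw [if_pos (eq_identity_label hD hp)]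
      exact tendsto_const_nhds.congr fun X => (term_eq_one hD hp _ _).symm
    · have hne : p ≠ ⟨0, 0⟩ := fun h => hp (by rw [h])
      rw [if_neg hne, tendsto_zero_iff_norm_tendsto_zero]
      have hb := hbar_pos hD hp
      have h1 : Tendsto (fun X : ℝ => X ^ D.hbar p) (𝓝[>] 0) (𝓝 0) := by
        have := (Real.continuousAt_rpow_const 0 (D.hbar p) (Or.inr hb.le)).tendsto
        rw [Real.zero_rpow hb.ne'] at this
        exact this.mono_left nhdsWithin_le_nhds
      have h2 := h1.const_mul (D.c p.1 p.2 * z ^ D.h p)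
      rw [mul_zero] at h2
      refine h2.congr' ?_
      filter_upwards [self_mem_nhdsWithin] with X hX
      rw [norm_term_ofReal hD hz hX]
  · filter_upwards [self_mem_nhdsWithin,
      (eventually_lt_nhds (by norm_num : (0 : ℝ) < 1 / 2)).filter_mono nhdsWithin_le_nhds]
      with X (hX : 0 < X) hX1 p
    rw [norm_term_ofReal hD hz hX, norm_term_ofReal hD hz (by norm_num)]
    have hc := hD.c_nonneg p.1 p.2 (Nat.lt_succ_iff.1 p.2.2)
    have hb : 0 ≤ D.hbar p := by
      by_cases hp : p.1 = 0
      · rw [hbar_eq_zero hD hp]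
      · exact (hbar_pos hD hp).le
    gcongr

end CorrelatorData

namespace LightconeData

variable {ι : Type*} {L : LightconeData ι} {D : CorrelatorData}

/-- The coefficients of the blocks at fixed `x`. -/
noncomputable def weight (L : LightconeData ι) (Δ x : ℝ) (i : ι) : ℝ := L.d i * x ^ (L.h i - Δ)

theorem weight_nonneg (hL : L.IsExpansionOf D) {Δ x : ℝ} (hx : 0 < x) (i : ι) :
    0 ≤ L.weight Δ x i :=
  mul_nonneg (hL.d_nonneg i) (Real.rpow_nonneg hx.le _)

theorem hasSum_weight_mul_lightconeBlock (hL : L.IsExpansionOf D) {x y : ℝ} (hx : 0 < x)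
    (hx1 : x < 1) (hy : 0 < y) (hy1 : y < 1) :
    HasSum (fun i => ((L.weight D.Δ x i * lightconeBlock (L.hbar i) y : ℝ) : ℂ))
      (((y ^ D.Δ : ℝ) : ℂ) * D.G x y) := by
  refine ((hL.hasSum x y hx hx1 hy hy1).mul_left ((y ^ D.Δ : ℝ) : ℂ)).congr_fun fun i => ?_
  rw [← Complex.ofReal_mul]
  congr 1
  rw [Real.rpow_neg hy.le, weight]
  have : 0 < y ^ D.Δ := by positivity
  field_simp

theorem summable_weight_mul_lightconeBlock (hL : L.IsExpansionOf D) {x y : ℝ} (hx : 0 < x)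
    (hx1 : x < 1) (hy : 0 < y) (hy1 : y < 1) :
    Summable fun i => L.weight D.Δ x i * lightconeBlock (L.hbar i) y :=
  Complex.summable_ofReal.1 (hasSum_weight_mul_lightconeBlock hL hx hx1 hy hy1).summable

/-- Crossing symmetry turns the identity contribution into the singularity at `y = 1`. -/
theorem tendsto_rpow_mul_tsum_weight_mul_lightconeBlock (hD : D.IsCorrelator)
    (hL : L.IsExpansionOf D) {x : ℝ} (hx : 0 < x) (hx1 : x < 1) :
    Tendsto (fun X : ℝ => X ^ D.Δ *
      ∑' i, L.weight D.Δ x i * lightconeBlock (L.hbar i) (1 - X)) (𝓝[>] 0)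
      (𝓝 ((1 - x) ^ (-D.Δ))) := by
  rw [← tendsto_ofReal_iff]
  have h1 : Tendsto (fun X : ℝ => (((1 - X) ^ D.Δ : ℝ) : ℂ)) (𝓝[>] 0) (𝓝 1) := by
    have : Tendsto (fun X : ℝ => (1 - X) ^ D.Δ) (𝓝 0) (𝓝 ((1 - 0) ^ D.Δ)) :=
      (ContinuousAt.rpow_const (by fun_prop) (Or.inr hD.Δ_pos.le))
    rw [sub_zero, Real.one_rpow] at this
    exact_mod_cast (this.mono_left nhdsWithin_le_nhds).ofReal
  have h2 := ((h1.mul_const (((1 - x) ^ (-D.Δ) : ℝ) : ℂ)).mul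
    (CorrelatorData.tendsto_tsum_term hD (by linarith : 0 < 1 - x) (by linarith)))
  rw [one_mul, mul_one] at h2
  refine h2.congr' ?_
  filter_upwards [self_mem_nhdsWithin,
    (eventually_lt_nhds one_pos).filter_mono nhdsWithin_le_nhds] with X (hX : 0 < X) hX1
  have hX' : 0 < 1 - X := by linarith
  have hx' : 0 < 1 - x := by linarith
  rw [Complex.ofReal_mul, Complex.ofReal_tsum]
  have h3 := (hasSum_weight_mul_lightconeBlock hL hx hx1 hX' (by linarith)).tsum_eq
  rw [h3]
  have h4 : D.G x ((1 - X : ℝ) : ℂ) = D.G ((1 - x : ℝ) : ℂ) X := by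
    have hn : ∀ r : ℝ, 0 < r → r < 1 → ‖(r : ℂ)‖ < 1 := fun r h0 h1 => by
      rw [Complex.norm_real, Real.norm_of_nonneg h0.le]; exact h1
    have := hD.crossing x ((1 - X : ℝ) : ℂ) (hn _ hx hx1)
      (by simpa using hn (1 - x) hx' (by linarith)) (hn _ hX' (by linarith))
      (by simpa using hn X hX hX1)
    rw [this]
    push_cast
    rw [sub_sub_cancel]
  rw [h4, CorrelatorData.G, ← Complex.ofReal_neg, ← Complex.ofReal_cpow hx'.le,
    ← Complex.ofReal_cpow hX.le]
  have h5 : ((X ^ D.Δ : ℝ) : ℂ) * ((X ^ (-D.Δ) : ℝ) : ℂ) = 1 := by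
    rw [← Complex.ofReal_mul, ← Real.rpow_add hX, add_neg_cancel, Real.rpow_zero,
      Complex.ofReal_one]
  calc _ = (((X ^ D.Δ : ℝ) : ℂ) * ((X ^ (-D.Δ) : ℝ) : ℂ)) *
        ((((1 - X) ^ D.Δ : ℝ) : ℂ) * (((1 - x) ^ (-D.Δ) : ℝ) : ℂ) *
          ∑' p, D.term ((1 - x : ℝ) : ℂ) X p) := by rw [h5, one_mul]
    _ = _ := by ring

theorem summable_ite_weight (hL : L.IsExpansionOf D) {x : ℝ} (hx : 0 < x) (hx1 : x < 1)
    (Λ : ℝ) : Summable fun i => if L.hbar i ≤ Λ then L.weight D.Δ x i else 0 :=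
  summable_ite_le hL.hbar_nonneg (weight_nonneg hL hx)
    (fun _ hy hy1 => summable_weight_mul_lightconeBlock hL hx hx1 hy hy1) Λ

theorem tendsto_tsum_weight_of_real (hD : D.IsCorrelator) (hL : L.IsExpansionOf D) {x : ℝ}
    (hx : 0 < x) (hx1 : x < 1) :
    Tendsto (fun Λ : ℝ => Λ ^ (-2 * D.Δ) * ∑' i, if L.hbar i ≤ Λ then L.weight D.Δ x i else 0)
      atTop (𝓝 (2 * Real.sqrt Real.pi * (1 - x) ^ (-D.Δ) /
        (Real.Gamma D.Δ * Real.Gamma (D.Δ + 1)))) := by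
  have hsum : ∀ y : ℝ, 0 < y → y < 1 →
      Summable fun i => L.weight D.Δ x i * lightconeBlock (L.hbar i) y :=
    fun _ hy hy1 => summable_weight_mul_lightconeBlock hL hx hx1 hy hy1
  -- only countably many labels have a nonzero coefficient
  set s : Set ι := Function.support (L.weight D.Δ x) with hs
  have hcount : s.Countable := by
    refine ((hsum (1 / 2) (by norm_num) (by norm_num)).countable_support).mono fun i hi => ?_
    exact mul_ne_zero hi (lightconeBlock_pos (hL.hbar_nonneg i) (by norm_num) (by norm_num)).ne'
  have : Countable s := hcount.to_subtype
  have htsum : ∀ g : ι → ℝ, Function.support g ⊆ s → ∑' i : s, g i = ∑' i, g i :=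
    fun g hg => tsum_subtype_eq_of_support_subset hg
  have h := tendsto_tsum_weight (ι := s) (v := fun i => L.hbar i)
    (W := fun i => L.weight D.Δ x i) (Δ := D.Δ) (A := (1 - x) ^ (-D.Δ))
    (fun i => hL.hbar_nonneg i) (fun i => weight_nonneg hL hx i) hD.Δ_pos
    (fun y hy hy1 => (hsum y hy hy1).subtype s) (by
      refine (tendsto_rpow_mul_tsum_weight_mul_lightconeBlock hD hL hx hx1).congr fun X => ?_
      rw [htsum (fun i => L.weight D.Δ x i * lightconeBlock (L.hbar i) (1 - X))]
      exact Function.support_mul_subset_left _ _)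
  refine h.congr fun Λ => ?_
  rw [htsum (fun i => if L.hbar i ≤ Λ then L.weight D.Δ x i else 0)]
  intro i hi
  by_contra h0
  have h0' : L.weight D.Δ x i = 0 := by simpa [hs] using h0
  simp [h0'] at hi

end LightconeData

/-! ### The limit of the twist density -/

/-- The mass at `Δ + m` of the limiting twist density. -/
noncomputable def limitMass (Δ : ℝ) (m : ℕ) : ℝ :=
  2 * Real.sqrt Real.pi * Real.Gamma (m + Δ) /
    (m.factorial * Real.Gamma Δ ^ 2 * Real.Gamma (Δ + 1))

/-- The limiting twist density, with masses at the double-twist values `Δ + m`. -/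
noncomputable def limitTwistDensity (Δ : ℝ) : Measure ℝ :=
  Measure.sum fun m : ℕ => ENNReal.ofReal (limitMass Δ m) • Measure.dirac (Δ + m)

theorem limitMass_eq {Δ : ℝ} (hΔ : 0 < Δ) (m : ℕ) :
    limitMass Δ m = 2 * Real.sqrt Real.pi / (Real.Gamma Δ * Real.Gamma (Δ + 1)) *
      ((ascPochhammer ℝ m).eval Δ / m.factorial) := by
  have h1 := (Real.Gamma_pos_of_pos hΔ).ne'
  have h2 := (Real.Gamma_pos_of_pos (by linarith : 0 < Δ + 1)).ne'
  rw [limitMass, add_comm, Real.Gamma_add_natCast_eq_mul hΔ]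
  field_simp

theorem limitMass_nonneg {Δ : ℝ} (hΔ : 0 < Δ) (m : ℕ) : 0 ≤ limitMass Δ m := by
  have h1 := Real.Gamma_pos_of_pos hΔ
  have h2 := Real.Gamma_pos_of_pos (by linarith : 0 < Δ + 1)
  have h3 := Real.Gamma_pos_of_pos (by positivity : 0 < (m : ℝ) + Δ)
  unfold limitMass
  positivity

theorem hasSum_limitMass_mul_exp {Δ : ℝ} (hΔ : 0 < Δ) {w : ℂ} (hw : w.re < 0) :
    HasSum (fun m : ℕ => (limitMass Δ m : ℂ) * Complex.exp (((Δ + m : ℝ) : ℂ) * w))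
      (((2 * Real.sqrt Real.pi / (Real.Gamma Δ * Real.Gamma (Δ + 1)) : ℝ) : ℂ) *
        Complex.exp (Δ * w) * (1 - Complex.exp w) ^ (-Δ : ℂ)) := by
  have h := (Complex.hasSum_ascPochhammer_mul_pow Δ (z := Complex.exp w)
    (by rw [Complex.norm_exp]; exact Real.exp_lt_one_iff.2 hw)).mul_left
      (((2 * Real.sqrt Real.pi / (Real.Gamma Δ * Real.Gamma (Δ + 1)) : ℝ) : ℂ) *
        Complex.exp (Δ * w))
  refine h.congr_fun fun m => ?_
  rw [limitMass_eq hΔ, ← Complex.exp_nat_mul]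
  push_cast
  rw [add_mul, Complex.exp_add]
  ring

theorem integrable_exp_limitTwistDensity {Δ b : ℝ} (hΔ : 0 < Δ) (hb : 0 < b) :
    Integrable (fun s => Real.exp (-(b * s))) (limitTwistDensity Δ) := by
  refine integrable_sum_smul_dirac (limitMass_nonneg hΔ) (by fun_prop) ?_
  have h := (hasSum_limitMass_mul_exp hΔ (w := ((-b : ℝ) : ℂ)) (by simpa using hb)).summable.norm
  refine h.congr fun m => ?_
  rw [norm_mul, Complex.norm_real, Real.norm_of_nonneg (limitMass_nonneg hΔ m), Complex.norm_exp,
    Real.norm_eq_abs, Real.abs_exp]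
  congr 2
  rw [← Complex.ofReal_mul, Complex.ofReal_re]
  ring

theorem integral_cexp_limitTwistDensity {Δ : ℝ} (hΔ : 0 < Δ) {w : ℂ} (hw : w.re < 0) :
    ∫ s, Complex.exp ((s : ℂ) * w) ∂limitTwistDensity Δ =
      ((2 * Real.sqrt Real.pi / (Real.Gamma Δ * Real.Gamma (Δ + 1)) : ℝ) : ℂ) *
        Complex.exp (Δ * w) * (1 - Complex.exp w) ^ (-Δ : ℂ) := by
  have hm : StronglyMeasurable fun s : ℝ => Complex.exp ((s : ℂ) * w) :=
    Continuous.stronglyMeasurable (by fun_prop)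
  have hint : Integrable (fun s : ℝ => Complex.exp ((s : ℂ) * w)) (limitTwistDensity Δ) := by
    refine (integrable_exp_limitTwistDensity hΔ (b := -w.re) (by linarith)).mono'
      hm.aestronglyMeasurable (ae_of_all _ fun s => ?_)
    rw [Complex.norm_exp, Complex.re_ofReal_mul]
    exact Real.exp_le_exp.2 (by linarith)
  rw [limitTwistDensity, ← (hasSum_integral_sum_smul_dirac (limitMass_nonneg hΔ) hm hint).tsum_eq,
    ← (hasSum_limitMass_mul_exp hΔ hw).tsum_eq]
  exact tsum_congr fun m => Complex.real_smul

namespace LightconeData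

variable {ι : Type*} {L : LightconeData ι} {D : CorrelatorData}

theorem norm_expTerm (hL : L.IsExpansionOf D) (Δ : ℝ) (w : ℂ) (i : ι) :
    ‖L.expTerm Δ w i‖ = L.weight Δ (Real.exp w.re) i := by
  rw [expTerm, norm_mul, Complex.norm_real, Real.norm_of_nonneg (hL.d_nonneg i),
    Complex.norm_exp, Complex.re_ofReal_mul, weight, ← Real.exp_mul, mul_comm w.re]

theorem summable_norm_expTerm (hL : L.IsExpansionOf D) {w : ℂ} (hw : w.re < 0) (Λ : ℝ) :
    Summable fun i : {i : ι // L.hbar i ≤ Λ} => ‖L.expTerm D.Δ w i‖ := by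
  have h := (summable_ite_weight hL (Real.exp_pos w.re) (Real.exp_lt_one_iff.2 hw) Λ).subtype
    {i | L.hbar i ≤ Λ}
  refine h.congr fun i => ?_
  have hi : L.hbar i.1 ≤ Λ := i.2
  rw [norm_expTerm hL, Function.comp_apply, if_pos hi]

theorem stronglyMeasurable_cexp (w : ℂ) :
    StronglyMeasurable fun s : ℝ => Complex.exp ((s : ℂ) * w) :=
  Continuous.stronglyMeasurable (by fun_prop)

theorem integrable_cexp_twistDensity (hL : L.IsExpansionOf D) {w : ℂ} (hw : w.re < 0) (Λ : ℝ) :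
    Integrable (fun s : ℝ => Complex.exp ((s : ℂ) * w)) (L.twistDensity Λ) := by
  refine integrable_sum_smul_dirac (c := fun i : {i : ι // L.hbar i ≤ Λ} => L.d i)
    (x := fun i => L.h i) (fun i => hL.d_nonneg i) (stronglyMeasurable_cexp w) ?_
  refine ((summable_norm_expTerm hL hw Λ).mul_left (Real.exp (D.Δ * w.re))).congr fun i => ?_
  rw [norm_expTerm hL, weight, ← Real.exp_mul, Complex.norm_exp, Complex.re_ofReal_mul,
    mul_left_comm, ← Real.exp_add]
  congr 2
  ring

theorem tsum_expTerm (hL : L.IsExpansionOf D) {w : ℂ} (hw : w.re < 0) (Λ : ℝ) :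
    ∑' i : {i : ι // L.hbar i ≤ Λ}, L.expTerm D.Δ w i =
      Complex.exp (-(D.Δ * w)) * ∫ s, Complex.exp ((s : ℂ) * w) ∂L.twistDensity Λ := by
  have h := (hasSum_integral_sum_smul_dirac (x := fun i : {i : ι // L.hbar i ≤ Λ} => L.h i)
    (fun i => hL.d_nonneg i) (stronglyMeasurable_cexp w)
    (integrable_cexp_twistDensity hL hw Λ)).mul_left (Complex.exp (-(D.Δ * w)))
  rw [twistDensity, ← h.tsum_eq]
  refine tsum_congr fun i => ?_
  rw [expTerm, Complex.real_smul, mul_left_comm, ← Complex.exp_add]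
  congr 2
  push_cast
  ring

theorem integrable_exp_twistDensity (hL : L.IsExpansionOf D) {b : ℝ} (hb : 0 < b) (Λ : ℝ) :
    Integrable (fun s => Real.exp (-(b * s))) (L.twistDensity Λ) := by
  have h := (integrable_cexp_twistDensity hL (w := ((-b : ℝ) : ℂ)) (by simpa using hb) Λ).norm
  refine h.congr (ae_of_all _ fun s => ?_)
  simp only
  rw [Complex.norm_exp, ← Complex.ofReal_mul, Complex.ofReal_re]
  congr 1
  ring

theorem ae_exp_mem_Icc_twistDensity (hL : L.IsExpansionOf D) {b : ℝ} (hb : 0 < b) (Λ : ℝ) :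
    ∀ᵐ s ∂L.twistDensity Λ, Real.exp (-(b * s)) ∈ Icc (0 : ℝ) 1 := by
  have h : ∀ᵐ s ∂L.twistDensity Λ, 0 ≤ s := ae_nonneg_sum_smul_dirac fun i => hL.h_nonneg i
  filter_upwards [h] with s hs
  exact ⟨(Real.exp_pos _).le, Real.exp_le_one_iff.2 (by have := mul_nonneg hb.le hs; linarith)⟩

theorem tendsto_integral_exp_twistDensity (hD : D.IsCorrelator) (hL : L.IsExpansionOf D) {b : ℝ}
    (hb : 0 < b) :
    Tendsto (fun Λ : ℝ => Λ ^ (-2 * D.Δ) * ∫ s, Real.exp (-(b * s)) ∂L.twistDensity Λ) atTop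
      (𝓝 (∫ s, Real.exp (-(b * s)) ∂limitTwistDensity D.Δ)) := by
  have hw : (((-b : ℝ) : ℂ)).re < 0 := by simpa using hb
  have hcexp : ∀ s : ℝ, Complex.exp ((s : ℂ) * ((-b : ℝ) : ℂ)) =
      ((Real.exp (-(b * s)) : ℝ) : ℂ) := fun s => by
    push_cast; ring_nf
  have hx1 : Real.exp (-b) < 1 := Real.exp_lt_one_iff.2 (by linarith)
  have hlim : ∫ s, Real.exp (-(b * s)) ∂limitTwistDensity D.Δ = Real.exp (-(D.Δ * b)) *
      (2 * Real.sqrt Real.pi * (1 - Real.exp (-b)) ^ (-D.Δ) /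
        (Real.Gamma D.Δ * Real.Gamma (D.Δ + 1))) := by
    have h := integral_cexp_limitTwistDensity hD.Δ_pos hw
    simp only [hcexp] at h
    rw [integral_complex_ofReal, ← Complex.ofReal_exp, ← Complex.ofReal_one, ← Complex.ofReal_sub,
      ← Complex.ofReal_neg, ← Complex.ofReal_cpow (by linarith), ← Complex.ofReal_mul,
      ← Complex.ofReal_mul, Complex.ofReal_inj] at h
    rw [h, mul_comm D.Δ b]
    ring
  rw [hlim]
  refine ((tendsto_tsum_weight_of_real hD hL (Real.exp_pos (-b)) hx1).const_mul
    (Real.exp (-(D.Δ * b)))).congr fun Λ => ?_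
  have h1 : ∑' i, (if L.hbar i ≤ Λ then L.weight D.Δ (Real.exp (-b)) i else 0) =
      Real.exp (D.Δ * b) * ∫ s, Real.exp (-(b * s)) ∂L.twistDensity Λ := by
    have hint := integrable_exp_twistDensity hL hb Λ
    have hs := ((hasSum_integral_sum_smul_dirac
      (x := fun i : {i : ι // L.hbar i ≤ Λ} => L.h i) (fun i => hL.d_nonneg i)
      (by fun_prop) hint).mul_left (Real.exp (D.Δ * b)))
    rw [twistDensity, ← hs.tsum_eq]
    have hind : ∀ i, (if L.hbar i ≤ Λ then L.weight D.Δ (Real.exp (-b)) i else 0) =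
        indicator {i | L.hbar i ≤ Λ} (L.weight D.Δ (Real.exp (-b))) i := fun i => by
      by_cases h : L.hbar i ≤ Λ <;> simp [h]
    simp_rw [hind]
    rw [← tsum_subtype]
    refine tsum_congr fun i => ?_
    rw [weight, ← Real.exp_mul, smul_eq_mul, mul_left_comm, ← Real.exp_add]
    congr 2
    ring
  rw [h1, Real.exp_neg]
  have := (Real.exp_pos (D.Δ * b)).ne'
  field_simp

/-- Convergence of the twist densities against functions `exp (-b s) * f (exp (-b s))` with `f`
continuous: the Laplace transforms at the points `(k + 1) b` are the moments of the
pushforward to `[0, 1]`. -/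
theorem tendsto_integral_twistDensity (hD : D.IsCorrelator) (hL : L.IsExpansionOf D) {b : ℝ}
    (hb : 0 < b) {f : ℝ → ℂ} (hf : Continuous f) :
    Tendsto (fun Λ : ℝ => ((Λ ^ (-2 * D.Δ) : ℝ) : ℂ) *
      ∫ s, (Real.exp (-(b * s)) : ℂ) * f (Real.exp (-(b * s))) ∂L.twistDensity Λ) atTop
      (𝓝 (∫ s, (Real.exp (-(b * s)) : ℂ) * f (Real.exp (-(b * s))) ∂limitTwistDensity D.Δ)) := by
  refine tendsto_integral_mul_comp_of_moments_complex
    (T := fun (_ : ℝ) s => Real.exp (-(b * s))) (S := fun s => Real.exp (-(b * s)))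
    (c := fun Λ : ℝ => Λ ^ (-2 * D.Δ)) (μ := L.twistDensity)
    ((eventually_ge_atTop 0).mono fun Λ hΛ => Real.rpow_nonneg hΛ _)
    (Eventually.of_forall (ae_exp_mem_Icc_twistDensity hL hb))
    (Eventually.of_forall (integrable_exp_twistDensity hL hb)) ?_
    (integrable_exp_limitTwistDensity hD.Δ_pos hb) (fun k => ?_) hf
  · have h : ∀ᵐ s ∂limitTwistDensity D.Δ, 0 ≤ s :=
      ae_nonneg_sum_smul_dirac fun m => by have := hD.Δ_pos; positivity
    filter_upwards [h] with s hs
    exact ⟨(Real.exp_pos _).le, Real.exp_le_one_iff.2 (by have := mul_nonneg hb.le hs; linarith)⟩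
  · have e : ∀ s : ℝ, Real.exp (-(b * s)) ^ (k + 1) = Real.exp (-(((k + 1) * b) * s)) := fun s => by
      rw [← Real.exp_nat_mul]
      congr 1
      push_cast
      ring
    simp_rw [e]
    exact tendsto_integral_exp_twistDensity hD hL (by positivity)

theorem tendsto_integral_cexp_twistDensity (hD : D.IsCorrelator) (hL : L.IsExpansionOf D) {w : ℂ}
    (hw : w.re < 0) :
    Tendsto (fun Λ : ℝ => ((Λ ^ (-2 * D.Δ) : ℝ) : ℂ) *
      ∫ s, Complex.exp ((s : ℂ) * w) ∂L.twistDensity Λ) atTop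
      (𝓝 (∫ s, Complex.exp ((s : ℂ) * w) ∂limitTwistDensity D.Δ)) := by
  -- with `t = exp (-b s)` and `b = -re w / 2`, the integrand is `t * t ^ c` with `re c = 1`
  set b : ℝ := -w.re / 2 with hbdef
  have hb : 0 < b := by rw [hbdef]; linarith
  set c : ℂ := -w / (b : ℂ) - 1 with hc
  have hb' : (b : ℂ) ≠ 0 := by exact_mod_cast hb.ne'
  have hcre : c.re = 1 := by
    have := hw.ne
    rw [hc, Complex.sub_re, Complex.div_ofReal_re, Complex.neg_re, Complex.one_re, hbdef]
    field_simp
    ring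
  have h := tendsto_integral_twistDensity hD hL hb (f := fun t : ℝ => (t : ℂ) ^ c)
    (Complex.continuous_ofReal_cpow_const (by rw [hcre]; exact one_pos))
  have e : ∀ s : ℝ, (Real.exp (-(b * s)) : ℂ) * (Real.exp (-(b * s)) : ℂ) ^ c =
      Complex.exp ((s : ℂ) * w) := by
    intro s
    have hne : ((Real.exp (-(b * s)) : ℝ) : ℂ) ≠ 0 := by exact_mod_cast (Real.exp_pos _).ne'
    rw [Complex.cpow_def_of_ne_zero hne, ← Complex.ofReal_log (Real.exp_pos _).le, Real.log_exp,
      Complex.ofReal_exp, ← Complex.exp_add, hc]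
    congr 1
    push_cast
    field_simp
    ring
  simpa only [e] using h

/-- Grouping the labels `i` with `hbar i ≤ Λ` by the value of `hbar i`. -/
theorem tsum_f (hL : L.IsExpansionOf D) {w : ℂ} (hw : w.re < 0) (Λ : ℝ) :
    ∑' v : {v : ℝ // v ∈ Set.range L.hbar ∧ v ≤ Λ}, L.f D.Δ v w =
      ∑' i : {i : ι // L.hbar i ≤ Λ}, L.expTerm D.Δ w i := by
  let e : (Σ v : {v : ℝ // v ∈ Set.range L.hbar ∧ v ≤ Λ}, {i : ι // L.hbar i = v}) ≃
      {i : ι // L.hbar i ≤ Λ} :=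
    { toFun := fun p => ⟨p.2.1, p.2.2.le.trans p.1.2.2⟩
      invFun := fun i => ⟨⟨L.hbar i, ⟨i, rfl⟩, i.2⟩, ⟨i, rfl⟩⟩
      left_inv := by
        rintro ⟨⟨v, hv⟩, ⟨i, hi⟩⟩
        simp only at hi
        subst hi
        rfl
      right_inv := fun i => rfl }
  have hs : Summable fun i : {i : ι // L.hbar i ≤ Λ} => L.expTerm D.Δ w i :=
    (summable_norm_expTerm hL hw Λ).of_norm
  have hs' : Summable fun p => L.expTerm D.Δ w (e p) := e.summable_iff.2 hs
  rw [← e.tsum_eq, hs'.tsum_sigma]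
  rfl

/-- A compactly supported continuous function is bounded by a multiple of `exp (-s)`. -/
theorem exists_norm_le_mul_exp {φ : ℝ → ℂ} (hφ : Continuous φ) (hc : HasCompactSupport φ) :
    ∃ C : ℝ, ∀ s, ‖φ s‖ ≤ C * Real.exp (-(1 * s)) := by
  have h1 : HasCompactSupport fun s => (Real.exp s : ℂ) * φ s := hc.mul_left
  obtain ⟨C, hC⟩ := h1.exists_bound_of_continuous (by fun_prop)
  refine ⟨C, fun s => ?_⟩
  have := hC s
  rw [norm_mul, Complex.norm_real, Real.norm_eq_abs, Real.abs_exp] at this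
  rw [one_mul, Real.exp_neg, ← div_eq_mul_inv, le_div_iff₀ (Real.exp_pos s), mul_comm]
  exact this

end LightconeData

theorem mainTheorem4 (D : CorrelatorData) (hD : D.IsCorrelator)
    {ι : Type*} (L : LightconeData ι) (hL : L.IsExpansionOf D) :
    (∀ w : ℂ, w.re < 0 →
      (∀ Λ : ℝ, Summable fun i : {i : ι // L.hbar i ≤ Λ} => ‖L.expTerm D.Δ w i‖) ∧
      Filter.Tendsto (fun Λ : ℝ => L.F D.Δ Λ w) Filter.atTop
        (nhds ((1 - Complex.exp w) ^ (-D.Δ : ℂ)))) ∧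
    (∀ φ : ℝ → ℂ, ContDiff ℝ ∞ φ → HasCompactSupport φ →
      (∀ Λ : ℝ, MeasureTheory.Integrable φ (L.twistDensity Λ)) ∧
      Filter.Tendsto
        (fun Λ : ℝ => ((Λ ^ (-2 * D.Δ) : ℝ) : ℂ) * ∫ η, φ η ∂(L.twistDensity Λ)) Filter.atTop
        (nhds (∑' m : ℕ,
          ((2 * Real.sqrt Real.pi * Real.Gamma (m + D.Δ) /
            (m.factorial * Real.Gamma D.Δ ^ 2 * Real.Gamma (D.Δ + 1)) : ℝ) : ℂ) *
              φ (D.Δ + m)))) := by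
  have hΔ := hD.Δ_pos
  have hG := Real.Gamma_pos_of_pos hΔ
  have hG1 := Real.Gamma_pos_of_pos (by linarith : 0 < D.Δ + 1)
  have hpi : 0 < Real.sqrt Real.pi := Real.sqrt_pos.2 Real.pi_pos
  refine ⟨fun w hw => ⟨LightconeData.summable_norm_expTerm hL hw, ?_⟩, fun φ hφ hc => ?_⟩
  · set K : ℝ := 2 * Real.sqrt Real.pi / (Real.Gamma D.Δ * Real.Gamma (D.Δ + 1)) with hK
    have hK0 : (K : ℂ) ≠ 0 := by
      have : 0 < K := by positivity
      exact_mod_cast this.ne'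
    have h := (LightconeData.tendsto_integral_cexp_twistDensity hD hL hw).const_mul
      ((K : ℂ)⁻¹ * Complex.exp (-(D.Δ * w)))
    rw [integral_cexp_limitTwistDensity hΔ hw, ← hK] at h
    have hlim : (K : ℂ)⁻¹ * Complex.exp (-(D.Δ * w)) * ((K : ℂ) * Complex.exp (D.Δ * w) *
        (1 - Complex.exp w) ^ (-D.Δ : ℂ)) = (1 - Complex.exp w) ^ (-D.Δ : ℂ) := by
      rw [Complex.exp_neg]
      have := Complex.exp_ne_zero (D.Δ * w)
      field_simp
    rw [hlim] at h
    refine h.congr fun Λ => ?_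
    rw [LightconeData.F, LightconeData.tsum_f hL hw, LightconeData.tsum_expTerm hL hw]
    have hconst : 1 / (2 * Real.sqrt Real.pi) * Λ ^ (-2 * D.Δ) * Real.Gamma D.Δ *
        Real.Gamma (D.Δ + 1) = K⁻¹ * Λ ^ (-2 * D.Δ) := by
      rw [hK]
      field_simp
    rw [hconst]
    push_cast
    ring
  · have hφc : Continuous φ := hφ.continuous
    obtain ⟨C, hC⟩ := LightconeData.exists_norm_le_mul_exp hφc hc
    have hint : ∀ Λ : ℝ, Integrable φ (L.twistDensity Λ) := fun Λ =>
      ((LightconeData.integrable_exp_twistDensity hL one_pos Λ).const_mul C).mono'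
        hφc.stronglyMeasurable.aestronglyMeasurable (ae_of_all _ hC)
    refine ⟨hint, ?_⟩
    have hintlim : Integrable φ (limitTwistDensity D.Δ) :=
      ((integrable_exp_limitTwistDensity hΔ one_pos).const_mul C).mono'
        hφc.stronglyMeasurable.aestronglyMeasurable (ae_of_all _ hC)
    obtain ⟨b, hb⟩ := hc.isCompact.bddAbove
    have hzero : ∀ s, b + 1 ≤ s → φ s = 0 := fun s hs => by
      by_contra h0
      have := hb (subset_tsupport φ h0)
      linarith
    have h := LightconeData.tendsto_integral_twistDensity hD hL one_pos
      (continuous_expLift hφc (b + 1))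
    have e : ∀ s : ℝ,
        (Real.exp (-(1 * s)) : ℂ) * expLift φ (b + 1) (Real.exp (-(1 * s))) = φ s := by
      intro s
      rw [one_mul, ← Complex.real_smul, exp_neg_smul_expLift hzero]
    simp only [e] at h
    rw [limitTwistDensity,
      ← (hasSum_integral_sum_smul_dirac (limitMass_nonneg hΔ) hφc.stronglyMeasurable
      hintlim).tsum_eq] at h
    exact h
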